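/- Let $0<k<n$ be integers and $J=\{1,\dots,n\}$. Let $g_j=b_j^1t_1+\dots+b_j^kt_k$, $j\in J$, be nonzero linear functions on $\mathbb C^k$ that span the $k$-dimensional dual space, let $a_j$, $j\in J$, be nonzero complex numbers, and let $z\in\mathbb C^n$ be arbitrary (the arrangement need not have normal crossings; hyperplanes may even coincide). Put $f_j=z_j+g_j$, $H_j=\{f_j=0\}$, $U=\mathbb C^k\setminus\bigcup_j H_j$, let $\mathcal A(z)=(H_j)_{j\in J}$, and let $\Phi=\sum_j a_j\log f_j$ be the master function on $U$. Let $\mathcal A^p$ be the degree $p$ part of the Orlik–Solomon algebra of $\mathcal A(z)$, spanned by the symbols $(H_{j_1},\dots,H_{j_p})$; let $V=(\mathcal A^k)^*$ be the space of flags of $\mathcal A(z)$, let $\mathrm{Sing}\,V\subset V$ be the annihilator of $\big(\sum_j a_j(H_j)\big)\cdot\mathcal A^{k-1}$, and let $$S(F,F')=\sum_{\{j_1,\dots,j_k\}\subset J}a_{j_1}\cdots a_{j_k}\,\langle (H_{j_1},\dots,H_{j_k}),F\rangle\,\langle (H_{j_1},\dots,H_{j_k}),F'\rangle$$ be the contravariant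 form on $V$. Let $W\subset V^*$ be the image of $V$ under the map $V\to V^*$ defined by $S$, let $\mathrm{Sing}\,W\subset W$ be the image of $\mathrm{Sing}\,V$, and denote by $S$ also the form induced on $W$. For an isolated critical point $p\in U$ of $\Phi$, let $A_p$ be the algebra of germs at $p$ of holomorphic functions modulo the ideal generated by $\partial\Phi/\partial t_i$, $i=1,\dots,k$; let $\mu_p=\dim_{\mathbb C}A_p$ be the Milnor number, and let $(f,g)_p=\rho_p(fg)$ be the residue form on $A_p$, where $\rho_p$ is the Grothendieck residue with respect to $\partial\Phi/\partial t_1,\dots,\partial\Phi/\partial t_k$. For $\eta\in\mathcal A^k$ let $f_\eta$ be the rational function with $\eta=f_\eta\,dt_1\wedge\dots\wedge dt_k$ under $(H_j)\mapsto df_j/f_j$. Let $\alpha_p:A_p\to V$ be the map given by $\langle\eta,\alpha_p(g)\rangle=(g,[f_\eta])_p$, and let $Y_p\subset W$ be the image of $A_p$ under the composition of $\alpha_p$ with $V\to W$. Then: 1. the set of isolated critical points $p_1,\dots,p_d$ of $\Phi$ is finite, each $A_{p_s}$ is finite-dimensional, and $Y_{p_s}\subset\mathrm{Sing}\,W$;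 2. the sum of the subspaces $Y_{p_1},\dots,Y_{p_d}$ is direct, and these subspaces are pairwise orthogonal with respect to $S$; 3. $\sum_{s=1}^d\mu_{p_s}$ is at most the rank of $S|_{\mathrm{Sing}\,W}$, and at most the rank of $S|_{\mathrm{Sing}\,V}$. -/

import Mathlib

open scoped Topology

noncomputable section

/-! ### Germs of holomorphic functions -/

namespace HolGerm

/-- The algebra of functions on `ℂ^k` that are holomorphic in a neighbourhood of `p`. -/
def functionsAt {k : ℕ} (p : Fin k → ℂ) : Subalgebra ℂ ((Fin k → ℂ) → ℂ) where
  carrier := {f | AnalyticAt ℂ f p}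
  mul_mem' := fun hf hg => hf.mul hg
  add_mem' := fun hf hg => hf.add hg
  algebraMap_mem' := fun _ => analyticAt_const

/-- The functions that vanish identically in a neighbourhood of `p`. -/
def vanishing {k : ℕ} (p : Fin k → ℂ) : Ideal (functionsAt p) where
  carrier := {f | ∀ᶠ t in 𝓝 p, f.1 t = 0}
  zero_mem' := Filter.Eventually.of_forall fun _ => rfl
  add_mem' := fun {f g} hf hg => by
    filter_upwards [hf, hg] with t h1 h2
    change f.1 t + g.1 t = 0
    rw [h1, h2, add_zero]
  smul_mem' := fun c f hf => by
    filter_upwards [hf] with t h1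
    change c.1 t * f.1 t = 0
    rw [h1, mul_zero]

end HolGerm

/-- The algebra of germs at `p` of holomorphic functions on `ℂ^k`. -/
def HolGerm {k : ℕ} (p : Fin k → ℂ) : Type :=
  HolGerm.functionsAt p ⧸ HolGerm.vanishing p

namespace HolGerm

instance instCommRing {k : ℕ} (p : Fin k → ℂ) : CommRing (HolGerm p) :=
  inferInstanceAs (CommRing (functionsAt p ⧸ vanishing p))

instance instAlgebra {k : ℕ} (p : Fin k → ℂ) : Algebra ℂ (HolGerm p) :=
  inferInstanceAs (Algebra ℂ (functionsAt p ⧸ vanishing p))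

/-- The germ at `p` of a function holomorphic near `p`. -/
def mk {k : ℕ} {p : Fin k → ℂ} (f : (Fin k → ℂ) → ℂ) (hf : AnalyticAt ℂ f p) : HolGerm p :=
  Ideal.Quotient.mk (vanishing p) ⟨f, hf⟩

theorem mk_eq_mk {k : ℕ} {p : Fin k → ℂ} {f g : (Fin k → ℂ) → ℂ} {hf : AnalyticAt ℂ f p}
    {hg : AnalyticAt ℂ g p} : mk f hf = mk g hg ↔ ∀ᶠ t in 𝓝 p, f t = g t := by
  have h : mk f hf = mk g hg ↔ ∀ᶠ t in 𝓝 p, f t - g t = 0 :=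
    Ideal.Quotient.eq (I := vanishing p)
  simpa only [sub_eq_zero] using h

theorem mk_surj {k : ℕ} {p : Fin k → ℂ} (φ : HolGerm p) : ∃ f hf, φ = mk f hf := by
  obtain ⟨f, rfl⟩ := Ideal.Quotient.mk_surjective φ
  exact ⟨f.1, f.2, rfl⟩

/-- Evaluation of a germ at its base point. -/
def eval {k : ℕ} (p : Fin k → ℂ) : HolGerm p →ₐ[ℂ] ℂ :=
  Ideal.Quotient.liftₐ (vanishing p)
    ((Pi.evalAlgHom ℂ (fun _ : Fin k → ℂ => ℂ) p).comp (functionsAt p).val)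
    (fun f hf => by
      have h : ∀ᶠ t in 𝓝 p, f.1 t = 0 := hf
      exact h.self_of_nhds)

theorem analyticAt_partial {k : ℕ} {p : Fin k → ℂ} (i : Fin k) {f : (Fin k → ℂ) → ℂ}
    (hf : AnalyticAt ℂ f p) : AnalyticAt ℂ (fun t => fderiv ℂ f t (Pi.single i 1)) p :=
  (ContinuousLinearMap.analyticAt
    (ContinuousLinearMap.apply ℂ ℂ (Pi.single i (1 : ℂ) : Fin k → ℂ)) _).fun_comp hf.fderiv

/-- The partial derivative `∂/∂t_i` on functions holomorphic near `p`, with values in germs. -/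
def partialLin {k : ℕ} (p : Fin k → ℂ) (i : Fin k) : functionsAt p →ₗ[ℂ] HolGerm p where
  toFun f := mk (fun t => fderiv ℂ f.1 t (Pi.single i 1)) (analyticAt_partial i f.2)
  map_add' f g := by
    change _ = mk ((fun t => fderiv ℂ f.1 t (Pi.single i 1)) +
      (fun t => fderiv ℂ g.1 t (Pi.single i 1)))
      ((analyticAt_partial i f.2).add (analyticAt_partial i g.2))
    rw [mk_eq_mk]
    filter_upwards [f.2.eventually_analyticAt, g.2.eventually_analyticAt] with t h1 h2
    change fderiv ℂ (f.1 + g.1) t _ = _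
    rw [fderiv_add h1.differentiableAt h2.differentiableAt]
    rfl
  map_smul' c f := by
    change _ = mk (c • (fun t => fderiv ℂ f.1 t (Pi.single i 1)))
      ((analyticAt_partial i f.2).const_smul)
    rw [mk_eq_mk]
    filter_upwards [f.2.eventually_analyticAt] with t h1
    change fderiv ℂ (c • f.1) t _ = _
    rw [fderiv_const_smul h1.differentiableAt]
    rfl

theorem partialLin_vanishing {k : ℕ} (p : Fin k → ℂ) (i : Fin k) (f : functionsAt p)
    (hf : f ∈ vanishing p) : partialLin p i f = 0 := by
  change mk _ _ = mk (fun _ => 0) analyticAt_const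
  rw [mk_eq_mk]
  have h : ∀ᶠ t in 𝓝 p, f.1 t = (fun _ => (0 : ℂ)) t := hf
  filter_upwards [h.eventually_nhds] with t ht
  rw [Filter.EventuallyEq.fderiv_eq ht]
  simp

/-- The partial derivative `∂/∂t_i` of a germ of a holomorphic function. -/
def pderiv {k : ℕ} (p : Fin k → ℂ) (i : Fin k) : Derivation ℂ (HolGerm p) (HolGerm p) :=
  Derivation.mk'
    (((vanishing p).restrictScalars ℂ).liftQ (partialLin p i)
      (fun f hf => partialLin_vanishing p i f hf))
    (by
      intro φ ψ
      obtain ⟨f, hf, rfl⟩ := mk_surj φ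
      obtain ⟨g, hg, rfl⟩ := mk_surj ψ
      change mk (fun t => fderiv ℂ (f * g) t (Pi.single i 1)) (analyticAt_partial i (hf.mul hg)) =
        mk (f * (fun t => fderiv ℂ g t (Pi.single i 1)) +
          g * (fun t => fderiv ℂ f t (Pi.single i 1)))
          ((hf.mul (analyticAt_partial i hg)).add (hg.mul (analyticAt_partial i hf)))
      rw [mk_eq_mk]
      filter_upwards [hf.eventually_analyticAt, hg.eventually_analyticAt] with t h1 h2
      rw [fderiv_mul h1.differentiableAt h2.differentiableAt]
      rfl)

theorem pderiv_mk {k : ℕ} {p : Fin k → ℂ} (i : Fin k) (f : (Fin k → ℂ) → ℂ)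
    (hf : AnalyticAt ℂ f p) :
    pderiv p i (mk f hf) =
      mk (fun t => fderiv ℂ f t (Pi.single i 1)) (analyticAt_partial i hf) := rfl

theorem analyticAt_apply {k : ℕ} (p : Fin k → ℂ) (i : Fin k) :
    AnalyticAt ℂ (fun t : Fin k → ℂ => t i) p :=
  (ContinuousLinearMap.proj (R := ℂ) (φ := fun _ : Fin k => ℂ) i).analyticAt p

/-- The germ at `p` of the function `t ↦ t_i - p_i`. -/
def coord {k : ℕ} (p : Fin k → ℂ) (i : Fin k) : HolGerm p :=
  mk (fun t => t i - p i) ((analyticAt_apply p i).fun_sub analyticAt_const)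

theorem eval_coord {k : ℕ} (p : Fin k → ℂ) (i : Fin k) : eval p (coord p i) = 0 := by
  change p i - p i = 0
  exact sub_self _

theorem pderiv_coord_of_ne {k : ℕ} (p : Fin k → ℂ) {i j : Fin k} (h : j ≠ i) :
    pderiv p j (coord p i) = 0 := by
  rw [coord, pderiv_mk]
  change _ = mk (fun _ => 0) analyticAt_const
  rw [mk_eq_mk]
  refine Filter.Eventually.of_forall fun t => ?_
  have : HasFDerivAt (fun t : Fin k → ℂ => t i - p i)
      (ContinuousLinearMap.proj (R := ℂ) (φ := fun _ : Fin k => ℂ) i) t :=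
    (hasFDerivAt_apply i t).sub_const _
  rw [this.fderiv]
  simp [h.symm]

/-- The iterated partial derivative `∏_i (∂/∂t_i)^{α_i}` of germs. -/
def iteratedPderiv {k : ℕ} (p : Fin k → ℂ) (α : Fin k → ℕ) : HolGerm p →ₗ[ℂ] HolGerm p :=
  ((List.finRange k).map fun i => (pderiv p i).toLinearMap ^ α i).prod

/-- The coefficient of `∏_i (t_i - p_i)^{α_i}` in the Taylor expansion of a germ at `p`. -/
def coeff {k : ℕ} (p : Fin k → ℂ) (α : Fin k → ℕ) : HolGerm p →ₗ[ℂ] ℂ :=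
  ((∏ i, (Nat.factorial (α i) : ℂ))⁻¹) • ((eval p).toLinearMap ∘ₗ iteratedPderiv p α)

theorem pderiv_dvd_of_ne {k : ℕ} (p : Fin k → ℂ) {i j : Fin k} (h : j ≠ i) (m : ℕ)
    {φ : HolGerm p} (hφ : coord p i ^ m ∣ φ) : coord p i ^ m ∣ pderiv p j φ := by
  obtain ⟨ψ, rfl⟩ := hφ
  rw [Derivation.leibniz, Derivation.leibniz_pow, pderiv_coord_of_ne p h]
  simp

theorem pderiv_dvd {k : ℕ} (p : Fin k → ℂ) (i : Fin k) (m : ℕ)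
    {φ : HolGerm p} (hφ : coord p i ^ (m + 1) ∣ φ) : coord p i ^ m ∣ pderiv p i φ := by
  obtain ⟨ψ, rfl⟩ := hφ
  rw [Derivation.leibniz, Derivation.leibniz_pow]
  refine dvd_add ?_ ?_
  · rw [smul_eq_mul, pow_succ]
    exact ⟨coord p i * pderiv p i ψ, by ring⟩
  · refine ⟨ψ * ((m + 1 : ℕ) • pderiv p i (coord p i)), ?_⟩
    simp only [Nat.add_sub_cancel, smul_eq_mul, nsmul_eq_mul]
    ring

theorem pderiv_pow_dvd_of_ne {k : ℕ} (p : Fin k → ℂ) {i j : Fin k} (h : j ≠ i) (m r : ℕ)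
    {φ : HolGerm p} (hφ : coord p i ^ m ∣ φ) :
    coord p i ^ m ∣ ((pderiv p j).toLinearMap ^ r) φ := by
  induction r with
  | zero => simpa using hφ
  | succ r ih =>
    rw [pow_succ']
    exact pderiv_dvd_of_ne p h m ih

theorem pderiv_pow_dvd {k : ℕ} (p : Fin k → ℂ) (i : Fin k) (m r : ℕ)
    {φ : HolGerm p} (hφ : coord p i ^ (m + r) ∣ φ) :
    coord p i ^ m ∣ ((pderiv p i).toLinearMap ^ r) φ := by
  induction r generalizing m with
  | zero => simpa using hφ
  | succ r ih =>
    rw [pow_succ']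
    refine pderiv_dvd p i m (ih (m + 1) ?_)
    rwa [show m + 1 + r = m + (r + 1) by ring]

/-- A multiple of `(t_i - p_i)^{α_i + 1}` has zero Taylor coefficient at the index `α`. -/
theorem coeff_eq_zero {k : ℕ} (p : Fin k → ℂ) (α : Fin k → ℕ) (i : Fin k) {φ : HolGerm p}
    (hφ : coord p i ^ (α i + 1) ∣ φ) : coeff p α φ = 0 := by
  have key : ∀ l : List (Fin k), l.Nodup →
      coord p i ^ (if i ∈ l then 1 else α i + 1) ∣
        (l.map fun j => (pderiv p j).toLinearMap ^ α j).prod φ := by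
    intro l
    induction l with
    | nil => intro _; simpa using hφ
    | cons j l ih =>
      intro hl
      rw [List.nodup_cons] at hl
      have h := ih hl.2
      rw [List.map_cons, List.prod_cons, Module.End.mul_apply]
      by_cases hji : j = i
      · subst hji
        rw [if_neg hl.1] at h
        rw [if_pos List.mem_cons_self]
        exact pderiv_pow_dvd p j 1 (α j) (by rwa [add_comm 1])
      · have : (i ∈ j :: l) ↔ i ∈ l := by simp [Ne.symm hji]
        simp only [this]
        exact pderiv_pow_dvd_of_ne p hji _ _ h
  have h := key (List.finRange k) (List.nodup_finRange k)
  rw [if_pos (List.mem_finRange i), pow_one] at h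
  obtain ⟨ψ, hψ⟩ := h
  have : iteratedPderiv p α φ = coord p i * ψ := hψ
  simp [coeff, this, eval_coord]

/-! ### The Grothendieck residue

For germs `F_1, …, F_k` at `p` and the residue
`Res_p φ = (2πi)^{-k} ∫_{|F_1| = ε_1, …, |F_k| = ε_k} φ dt_1 ∧ … ∧ dt_k / (F_1 ⋯ F_k)`, the
transformation law says: if `G_i = ∑_j c_{ij} F_j` then the residue of `φ` with respect to `F` is
the residue of `det(c) φ` with respect to `G`. If `p` is an isolated common zero of the `F_j`, there
are such `G` of the form `G_i = (t_i - p_i)^N`, and for them the integral over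
`|t_i - p_i| = ε` is, by Cauchy's formula, the Taylor coefficient of `det(c) φ` at
`∏_i (t_i - p_i)^{N - 1}`. The value does not depend on the choice of `N` and `c`. -/

/-- A presentation `(t_i - p_i)^(N+1) = ∑_j c_{ij} F_j` of powers of the coordinates. -/
structure ResidueFrame {k : ℕ} {p : Fin k → ℂ} (F : Fin k → HolGerm p) where
  N : ℕ
  c : Matrix (Fin k) (Fin k) (HolGerm p)
  pow_eq : ∀ i, coord p i ^ (N + 1) = ∑ j, c i j * F j

/-- The Taylor coefficient of `det(c) φ` at `∏_i (t_i - p_i)^N`. -/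
def ResidueFrame.functional {k : ℕ} {p : Fin k → ℂ} {F : Fin k → HolGerm p}
    (D : ResidueFrame F) : HolGerm p →ₗ[ℂ] ℂ :=
  coeff p (fun _ => D.N) ∘ₗ LinearMap.mulLeft ℂ D.c.det

theorem ResidueFrame.functional_eq_zero {k : ℕ} {p : Fin k → ℂ} {F : Fin k → HolGerm p}
    (D : ResidueFrame F) {φ : HolGerm p} (hφ : φ ∈ Ideal.span (Set.range F)) :
    D.functional φ = 0 := by
  obtain ⟨g, rfl⟩ := (Ideal.mem_span_range_iff_exists_fun (R := HolGerm p)).1 hφ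
  rw [map_sum]
  refine Finset.sum_eq_zero fun j _ => ?_
  have h1 : D.c.det • F = D.c.adjugate.mulVec (fun i => coord p i ^ (D.N + 1)) := by
    have : (fun i => coord p i ^ (D.N + 1)) = D.c.mulVec F := by
      funext i
      exact D.pow_eq i
    rw [this, Matrix.mulVec_mulVec, Matrix.adjugate_mul, Matrix.smul_mulVec, Matrix.one_mulVec]
  have h2 : D.c.det * F j = ∑ i, D.c.adjugate j i * coord p i ^ (D.N + 1) := congrFun h1 j
  change coeff p (fun _ => D.N) (D.c.det * (g j * F j)) = 0
  rw [mul_left_comm, h2, Finset.mul_sum, map_sum]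
  refine Finset.sum_eq_zero fun i _ => coeff_eq_zero p _ i ?_
  exact ⟨g j * D.c.adjugate j i, by ring⟩

open Classical in
/-- The Grothendieck residue of germs at `p` with respect to `F_1, …, F_k`, as a functional on the
quotient of the algebra of germs by the ideal `(F_1, …, F_k)`. It is set to be `0` if the ideal
contains no powers of the coordinates, which does not happen at an isolated common zero. -/
def residue {k : ℕ} {p : Fin k → ℂ} (F : Fin k → HolGerm p) :
    (HolGerm p ⧸ Ideal.span (Set.range F)) →ₗ[ℂ] ℂ :=
  if h : Nonempty (ResidueFrame F) then
    ((Ideal.span (Set.range F)).restrictScalars ℂ).liftQ h.some.functional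
      (fun _ hφ => h.some.functional_eq_zero hφ)
  else 0

end HolGerm

/-! ### Bilinear forms -/

/-- For a symmetric form `B` on `V`, viewed as a map `V → V^*` with image `W`, the form on `W`
whose value at `(B v, B w)` is `B v w`. -/
def imageForm {V : Type*} [AddCommGroup V] [Module ℂ V] (B : LinearMap.BilinForm ℂ V)
    (hB : B.IsSymm) : LinearMap.BilinForm ℂ (LinearMap.range B) :=
  have key : ∀ (x y : LinearMap.range B) (w : V), B w = y.1 → x.1 y.2.choose = x.1 w := by
    rintro ⟨x, v, rfl⟩ y w hw
    change B v y.2.choose = B v w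
    rw [hB.eq v, hB.eq v, y.2.choose_spec, hw]
  LinearMap.mk₂ ℂ (fun x y => x.1 y.2.choose)
    (fun _ _ _ => rfl) (fun _ _ _ => rfl)
    (fun x y y' => by
      rw [key x (y + y') (y.2.choose + y'.2.choose)
        (by rw [map_add, y.2.choose_spec, y'.2.choose_spec]; rfl), map_add])
    (fun c x y => by
      rw [key x (c • y) (c • y.2.choose) (by rw [map_smul, y.2.choose_spec]; rfl), map_smul])

theorem imageForm_apply {V : Type*} [AddCommGroup V] [Module ℂ V] (B : LinearMap.BilinForm ℂ V)
    (hB : B.IsSymm) (v w : V) :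
    imageForm B hB (LinearMap.rangeRestrict B v) (LinearMap.rangeRestrict B w) = B v w := by
  have h := (LinearMap.rangeRestrict B w).2
  change B v h.choose = B v w
  rw [hB.eq v, hB.eq v, h.choose_spec]
  rfl

/-- The rank of a bilinear form. -/
def bilinRank {V : Type*} [AddCommMonoid V] [Module ℂ V] (B : LinearMap.BilinForm ℂ V) : ℕ :=
  Module.finrank ℂ (LinearMap.range B)

/-! ### Weighted affine arrangements

The data are the coefficients `b j i` of the linear functions `g_j = ∑_i b_j^i t_i` on `ℂ^k`, the
shifts `z j` and the weights `a j`, for `j` in `J = Fin n`. -/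

namespace Arrangement

/-- `f_j(z, t) = z_j + ∑_i b_j^i t_i`. -/
def affineForm {n k : ℕ} (b : Fin n → Fin k → ℂ) (z : Fin n → ℂ) (j : Fin n)
    (t : Fin k → ℂ) : ℂ :=
  z j + ∑ i, b j i * t i

/-- The hyperplane `H_j(z) = {f_j(z, ·) = 0}`. -/
def hyperplane {n k : ℕ} (b : Fin n → Fin k → ℂ) (z : Fin n → ℂ) (j : Fin n) :
    Set (Fin k → ℂ) :=
  {t | affineForm b z j t = 0}

/-- The complement `U` of the union of the hyperplanes. -/
def complement {n k : ℕ} (b : Fin n → Fin k → ℂ) (z : Fin n → ℂ) : Set (Fin k → ℂ) :=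
  (⋃ j, hyperplane b z j)ᶜ

/-- `H_{s_1}, …, H_{s_p}` are in general position: the intersection is nonempty and its codimension,
that is the rank of `g_{s_1}, …, g_{s_p}`, equals `p`. -/
def InGeneralPosition {n k p : ℕ} (b : Fin n → Fin k → ℂ) (z : Fin n → ℂ)
    (s : Fin p → Fin n) : Prop :=
  (⋂ i, hyperplane b z (s i)).Nonempty ∧ LinearIndependent ℂ fun i => b (s i)

/-- The relations between the symbols `(H_{s_1}, …, H_{s_p})`. -/
inductive OSRelation {n k : ℕ} (b : Fin n → Fin k → ℂ) (z : Fin n → ℂ) (p : ℕ) :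
    ((Fin p → Fin n) →₀ ℂ) → Prop
  | degenerate (s : Fin p → Fin n) (hs : ¬ InGeneralPosition b z s) :
      OSRelation b z p (Finsupp.single s 1)
  | skew (s : Fin p → Fin n) (σ : Equiv.Perm (Fin p)) :
      OSRelation b z p
        (Finsupp.single (s ∘ σ) 1 - ((Equiv.Perm.sign σ : ℤ) : ℂ) • Finsupp.single s 1)
  | boundary (s : Fin (p + 1) → Fin n) (hs : ¬ InGeneralPosition b z s)
      (hne : (⋂ i, hyperplane b z (s i)).Nonempty) :
      OSRelation b z p (∑ i : Fin (p + 1), (-1 : ℂ) ^ (i : ℕ) •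
        Finsupp.single (fun l => s (i.succAbove l)) 1)

/-- The degree `p` component of the Orlik–Solomon algebra. -/
abbrev OS {n k : ℕ} (b : Fin n → Fin k → ℂ) (z : Fin n → ℂ) (p : ℕ) : Type :=
  ((Fin p → Fin n) →₀ ℂ) ⧸ Submodule.span ℂ {x | OSRelation b z p x}

/-- The element `(H_{s_1}, …, H_{s_p})` of the Orlik–Solomon algebra. -/
def sym {n k p : ℕ} (b : Fin n → Fin k → ℂ) (z : Fin n → ℂ) (s : Fin p → Fin n) : OS b z p :=
  Submodule.Quotient.mk (Finsupp.single s 1)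

/-- The space of flags, as the dual of the component of the Orlik–Solomon algebra. -/
abbrev FlagSpace {n k : ℕ} (b : Fin n → Fin k → ℂ) (z : Fin n → ℂ) (p : ℕ) : Type :=
  Module.Dual ℂ (OS b z p)

/-- `ν(a) · OS^{p-1}`, where `ν(a) = ∑_j a_j (H_j)`: the span of the products
`ν(a) · (H_{s_1}, …, H_{s_{p-1}}) = ∑_j a_j (H_j, H_{s_1}, …, H_{s_{p-1}})`. -/
def nuImage {n k : ℕ} (a : Fin n → ℂ) (b : Fin n → Fin k → ℂ) (z : Fin n → ℂ) :
    (p : ℕ) → Submodule ℂ (OS b z p)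
  | 0 => ⊥
  | p + 1 => Submodule.span ℂ
      (Set.range fun s : Fin p → Fin n => ∑ j, a j • sym b z (Fin.cons j s : Fin (p + 1) → Fin n))

/-- The space of singular vectors: the annihilator of `ν(a) · OS^{p-1}`. -/
def singFlag {n k : ℕ} (a : Fin n → ℂ) (b : Fin n → Fin k → ℂ) (z : Fin n → ℂ) (p : ℕ) :
    Submodule ℂ (FlagSpace b z p) :=
  (nuImage a b z p).dualAnnihilator

open Classical in
/-- The contravariant form
`S(F, F') = ∑ a_{j_1} ⋯ a_{j_p} ⟨(H_{j_1}, …, H_{j_p}), F⟩ ⟨(H_{j_1}, …, H_{j_p}), F'⟩`,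
the sum over the `p`-element subsets `{j_1 < … < j_p}` of `J`. -/
def contravariantForm {n k : ℕ} (a : Fin n → ℂ) (b : Fin n → Fin k → ℂ) (z : Fin n → ℂ)
    (p : ℕ) : LinearMap.BilinForm ℂ (FlagSpace b z p) :=
  ∑ s : Fin p → Fin n with StrictMono s,
    (∏ i, a (s i)) • LinearMap.BilinForm.linMulLin
      (Module.Dual.eval ℂ (OS b z p) (sym b z s)) (Module.Dual.eval ℂ (OS b z p) (sym b z s))

theorem contravariantForm_isSymm {n k : ℕ} (a : Fin n → ℂ) (b : Fin n → Fin k → ℂ)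
    (z : Fin n → ℂ) (p : ℕ) : (contravariantForm a b z p).IsSymm := by
  refine ⟨fun x y => ?_⟩
  rw [contravariantForm, LinearMap.BilinForm.sum_apply, LinearMap.BilinForm.sum_apply]
  refine Finset.sum_congr rfl fun s _ => ?_
  change (∏ i, a (s i)) * (x (sym b z s) * y (sym b z s)) =
    (∏ i, a (s i)) * (y (sym b z s) * x (sym b z s))
  ring

/-- `W`, the image of `V = F^k` under the map `V → V^*` given by the contravariant form. -/
abbrev W {n k : ℕ} (a : Fin n → ℂ) (b : Fin n → Fin k → ℂ) (z : Fin n → ℂ) :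
    Submodule ℂ (Module.Dual ℂ (FlagSpace b z k)) :=
  LinearMap.range (contravariantForm a b z k)

/-- The map `V → W`. -/
def toW {n k : ℕ} (a : Fin n → ℂ) (b : Fin n → Fin k → ℂ) (z : Fin n → ℂ) :
    FlagSpace b z k →ₗ[ℂ] W a b z :=
  LinearMap.rangeRestrict (contravariantForm a b z k)

/-- `Sing W`, the image of `Sing V` in `W`. -/
def singW {n k : ℕ} (a : Fin n → ℂ) (b : Fin n → Fin k → ℂ) (z : Fin n → ℂ) :
    Submodule ℂ (W a b z) :=
  (singFlag a b z k).map (toW a b z)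

/-- The form on `W` induced by the contravariant form. -/
def formW {n k : ℕ} (a : Fin n → ℂ) (b : Fin n → Fin k → ℂ) (z : Fin n → ℂ) :
    LinearMap.BilinForm ℂ (W a b z) :=
  imageForm (contravariantForm a b z k) (contravariantForm_isSymm a b z k)

/-! ### The master function and its critical points -/

/-- The partial derivative `∂Φ/∂t_i = ∑_j a_j b_j^i / f_j` of the multivalued master function
`Φ = ∑_j a_j log f_j`. -/
def partialPhi {n k : ℕ} (a : Fin n → ℂ) (b : Fin n → Fin k → ℂ) (z : Fin n → ℂ) (i : Fin k)
    (t : Fin k → ℂ) : ℂ :=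
  ∑ j, a j * b j i / affineForm b z j t

/-- The critical points of the master function on `U`. -/
def criticalSet {n k : ℕ} (a : Fin n → ℂ) (b : Fin n → Fin k → ℂ) (z : Fin n → ℂ) :
    Set (Fin k → ℂ) :=
  {t | t ∈ complement b z ∧ ∀ i, partialPhi a b z i t = 0}

/-- The isolated critical points of the master function on `U`. -/
def isolatedCriticalSet {n k : ℕ} (a : Fin n → ℂ) (b : Fin n → Fin k → ℂ) (z : Fin n → ℂ) :
    Set (Fin k → ℂ) :=
  {p | p ∈ criticalSet a b z ∧ ∀ᶠ t in 𝓝[≠] p, t ∉ criticalSet a b z}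

theorem affineForm_ne_zero {n k : ℕ} {b : Fin n → Fin k → ℂ} {z : Fin n → ℂ} {p : Fin k → ℂ}
    (hp : p ∈ complement b z) (j : Fin n) : affineForm b z j p ≠ 0 :=
  fun h => hp (Set.mem_iUnion.2 ⟨j, h⟩)

theorem analyticAt_affineForm {n k : ℕ} (b : Fin n → Fin k → ℂ) (z : Fin n → ℂ) (j : Fin n)
    (p : Fin k → ℂ) : AnalyticAt ℂ (affineForm b z j) p :=
  analyticAt_const.add (Finset.analyticAt_fun_sum _ fun i _ =>
    analyticAt_const.mul (HolGerm.analyticAt_apply p i))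

theorem analyticAt_partialPhi {n k : ℕ} (a : Fin n → ℂ) (b : Fin n → Fin k → ℂ) (z : Fin n → ℂ)
    {p : Fin k → ℂ} (hp : p ∈ complement b z) (i : Fin k) :
    AnalyticAt ℂ (partialPhi a b z i) p :=
  Finset.analyticAt_fun_sum _ fun j _ =>
    analyticAt_const.div (analyticAt_affineForm b z j p) (affineForm_ne_zero hp j)

/-- The germs at `p ∈ U` of the partial derivatives of the master function. -/
def gradGerm {n k : ℕ} (a : Fin n → ℂ) (b : Fin n → Fin k → ℂ) (z : Fin n → ℂ)
    {p : Fin k → ℂ} (hp : p ∈ complement b z) (i : Fin k) : HolGerm p :=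
  HolGerm.mk (partialPhi a b z i) (analyticAt_partialPhi a b z hp i)

/-- The local algebra `A_{p,Φ}`: germs at `p` of holomorphic functions modulo the ideal generated
by the first derivatives of `Φ`. -/
abbrev LocalAlgebra {n k : ℕ} (a : Fin n → ℂ) (b : Fin n → Fin k → ℂ) (z : Fin n → ℂ)
    {p : Fin k → ℂ} (hp : p ∈ complement b z) : Type :=
  HolGerm p ⧸ Ideal.span (Set.range (gradGerm a b z hp))

/-- The Milnor number `μ_p = dim A_{p,Φ}`. -/
def milnorNumber {n k : ℕ} (a : Fin n → ℂ) (b : Fin n → Fin k → ℂ) (z : Fin n → ℂ)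
    {p : Fin k → ℂ} (hp : p ∈ complement b z) : ℕ :=
  Module.finrank ℂ (LocalAlgebra a b z hp)

/-- The residue form `(f, g)_p = ρ_p(f g)` on the local algebra. -/
def residueForm {n k : ℕ} (a : Fin n → ℂ) (b : Fin n → Fin k → ℂ) (z : Fin n → ℂ)
    {p : Fin k → ℂ} (hp : p ∈ complement b z) : LinearMap.BilinForm ℂ (LocalAlgebra a b z hp) :=
  (LinearMap.mul ℂ (LocalAlgebra a b z hp)).compr₂ (HolGerm.residue (gradGerm a b z hp))

/-! ### The canonical element -/

/-- The function `f` with `df_{s_1}/f_{s_1} ∧ … ∧ df_{s_k}/f_{s_k} = f dt_1 ∧ … ∧ dt_k`. -/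
def symFun {n k : ℕ} (b : Fin n → Fin k → ℂ) (z : Fin n → ℂ) (s : Fin k → Fin n)
    (t : Fin k → ℂ) : ℂ :=
  (Matrix.of fun l i => b (s l) i).det * ∏ l, (affineForm b z (s l) t)⁻¹

theorem analyticAt_symFun {n k : ℕ} (b : Fin n → Fin k → ℂ) (z : Fin n → ℂ) {p : Fin k → ℂ}
    (hp : p ∈ complement b z) (s : Fin k → Fin n) : AnalyticAt ℂ (symFun b z s) p :=
  analyticAt_const.mul (Finset.analyticAt_fun_prod _ fun l _ =>
    (analyticAt_affineForm b z (s l) p).fun_inv (affineForm_ne_zero hp (s l)))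

theorem det_eq_zero_of_not_inGeneralPosition {n k : ℕ} (b : Fin n → Fin k → ℂ) (z : Fin n → ℂ)
    (s : Fin k → Fin n) (hs : ¬ InGeneralPosition b z s) :
    (Matrix.of fun l i => b (s l) i).det = 0 := by
  by_contra hdet
  set M : Matrix (Fin k) (Fin k) ℂ := Matrix.of fun l i => b (s l) i with hM
  have hu : IsUnit M := (Matrix.isUnit_iff_isUnit_det M).2 (isUnit_iff_ne_zero.2 hdet)
  refine hs ⟨⟨M⁻¹.mulVec fun l => - z (s l), Set.mem_iInter.2 fun l => ?_⟩,
    Matrix.linearIndependent_rows_iff_isUnit.2 hu⟩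
  have h : M.mulVec (M⁻¹.mulVec fun l => - z (s l)) = fun l => - z (s l) := by
    rw [Matrix.mulVec_mulVec, Matrix.mul_nonsing_inv _ (isUnit_iff_ne_zero.2 hdet),
      Matrix.one_mulVec]
  have h' := congrFun h l
  change z (s l) + M.mulVec (M⁻¹.mulVec fun l => - z (s l)) l = 0
  rw [h']
  exact add_neg_cancel _

theorem sum_minors_eq_zero {n k : ℕ} (b : Fin n → Fin k → ℂ) (z : Fin n → ℂ)
    (s : Fin (k + 1) → Fin n) (hne : (⋂ i, hyperplane b z (s i)).Nonempty) (t : Fin k → ℂ) :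
    ∑ l : Fin (k + 1), (-1 : ℂ) ^ (l : ℕ) * affineForm b z (s l) t *
      (Matrix.of fun (m : Fin k) i => b (s (l.succAbove m)) i).det = 0 := by
  obtain ⟨t₀, ht₀⟩ := hne
  set A : Matrix (Fin (k + 1)) (Fin (k + 1)) ℂ :=
    Matrix.of fun l => Fin.cons (affineForm b z (s l) t) (b (s l)) with hA
  have h1 : A.det = ∑ l : Fin (k + 1), (-1 : ℂ) ^ (l : ℕ) * affineForm b z (s l) t *
      (Matrix.of fun (m : Fin k) i => b (s (l.succAbove m)) i).det :=
    Matrix.det_succ_column_zero A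
  rw [← h1]
  refine Matrix.exists_mulVec_eq_zero_iff.1
    ⟨Fin.cons 1 (t₀ - t), fun h => one_ne_zero (congrFun h 0), ?_⟩
  funext l
  have h0 : affineForm b z (s l) t₀ = 0 := Set.mem_iInter.1 ht₀ l
  have h2 : A.mulVec (Fin.cons 1 (t₀ - t)) l =
      affineForm b z (s l) t + ∑ i, b (s l) i * (t₀ i - t i) := by
    simp [hA, Matrix.mulVec, dotProduct, Fin.sum_univ_succ]
  rw [h2, Pi.zero_apply, ← h0]
  simp only [affineForm, mul_sub, Finset.sum_sub_distrib]
  ring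

theorem symFun_relation {n k : ℕ} (b : Fin n → Fin k → ℂ) (z : Fin n → ℂ) {t : Fin k → ℂ}
    (ht : t ∈ complement b z) {x : (Fin k → Fin n) →₀ ℂ} (hx : OSRelation b z k x) :
    Finsupp.linearCombination ℂ (fun s => symFun b z s t) x = 0 := by
  cases hx with
  | degenerate s hs =>
    simp [symFun, det_eq_zero_of_not_inGeneralPosition b z s hs]
  | skew s σ =>
    have h1 : (Matrix.of fun l i => b (s (σ l)) i).det =
        ((Equiv.Perm.sign σ : ℤ) : ℂ) * (Matrix.of fun l i => b (s l) i).det :=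
      Matrix.det_permute σ (Matrix.of fun l i => b (s l) i)
    have h2 : ∏ l, (affineForm b z (s (σ l)) t)⁻¹ = ∏ l, (affineForm b z (s l) t)⁻¹ :=
      Equiv.prod_comp σ fun l => (affineForm b z (s l) t)⁻¹
    simp only [map_sub, map_smul, Finsupp.linearCombination_single, smul_eq_mul,
      symFun, Function.comp_apply, h1, h2]
    ring
  | boundary s hs hne =>
    have h := sum_minors_eq_zero b z s hne t
    have h3 : ∀ l : Fin (k + 1), (-1 : ℂ) ^ (l : ℕ) * symFun b z (fun m => s (l.succAbove m)) t =
        (∏ m, (affineForm b z (s m) t)⁻¹) * ((-1 : ℂ) ^ (l : ℕ) * affineForm b z (s l) t *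
          (Matrix.of fun (m : Fin k) i => b (s (l.succAbove m)) i).det) := by
      intro l
      rw [Fin.prod_univ_succAbove _ l, symFun]
      have h0 : affineForm b z (s l) t ≠ 0 := affineForm_ne_zero ht _
      field_simp
    simp only [map_sum, map_smul, Finsupp.linearCombination_single, one_mul, smul_eq_mul, h3]
    rw [← Finset.mul_sum, h, mul_zero]

theorem eventually_mem_complement {n k : ℕ} {b : Fin n → Fin k → ℂ} {z : Fin n → ℂ}
    {p : Fin k → ℂ} (hp : p ∈ complement b z) : ∀ᶠ t in 𝓝 p, t ∈ complement b z := by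
  have h : ∀ᶠ t in 𝓝 p, ∀ j, affineForm b z j t ≠ 0 :=
    Filter.eventually_all.2 fun j =>
      (analyticAt_affineForm b z j p).continuousAt.eventually_ne (affineForm_ne_zero hp j)
  filter_upwards [h] with t ht hmem
  obtain ⟨j, hj⟩ := Set.mem_iUnion.1 hmem
  exact ht j hj

/-- The map `η ↦ f_η` from `OS^k` to germs at `p ∈ U`, where `f_η dt_1 ∧ … ∧ dt_k` is the
logarithmic form corresponding to `η`. Under `Hom(OS^k, A) = A ⊗ F^k` this is the canonical
element `E`. -/
def canonicalElement {n k : ℕ} (b : Fin n → Fin k → ℂ) (z : Fin n → ℂ) {p : Fin k → ℂ}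
    (hp : p ∈ complement b z) : OS b z k →ₗ[ℂ] HolGerm p :=
  (Submodule.span ℂ {x | OSRelation b z k x}).liftQ
    (Finsupp.linearCombination ℂ fun s =>
      HolGerm.mk (symFun b z s) (analyticAt_symFun b z hp s)) (by
    rw [Submodule.span_le]
    intro x hx
    let L : ((Fin k → Fin n) →₀ ℂ) →ₗ[ℂ] HolGerm.functionsAt p :=
      Finsupp.linearCombination ℂ fun s => ⟨symFun b z s, analyticAt_symFun b z hp s⟩
    let q : HolGerm.functionsAt p →ₗ[ℂ] HolGerm p :=
      (Ideal.Quotient.mkₐ ℂ (HolGerm.vanishing p)).toLinearMap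
    have h1 : Finsupp.linearCombination ℂ (fun s =>
        HolGerm.mk (symFun b z s) (analyticAt_symFun b z hp s)) = q ∘ₗ L := by
      refine Finsupp.lhom_ext' fun s => LinearMap.ext_ring ?_
      rw [LinearMap.comp_apply, LinearMap.comp_apply, LinearMap.comp_apply, Finsupp.lsingle_apply,
        Finsupp.linearCombination_single, Finsupp.linearCombination_single, one_smul, one_smul]
      rfl
    have h2 : ∀ t, (L x).1 t = Finsupp.linearCombination ℂ (fun s => symFun b z s t) x := by
      intro t
      let e : HolGerm.functionsAt p →ₗ[ℂ] ℂ :=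
        ((Pi.evalAlgHom ℂ (fun _ : Fin k → ℂ => ℂ) t).comp
          (HolGerm.functionsAt p).val).toLinearMap
      exact Finsupp.apply_linearCombination ℂ e _ x
    rw [SetLike.mem_coe, LinearMap.mem_ker, h1]
    refine Ideal.Quotient.eq_zero_iff_mem.2 ?_
    change ∀ᶠ t in 𝓝 p, (L x).1 t = 0
    filter_upwards [eventually_mem_complement hp] with t ht
    rw [h2, symFun_relation b z ht hx])

/-- The map `α_p : A_{p,Φ} → F^k`, `g ↦ (g, [E])_p`: the flag `α_p(g)`, as a functional on `OS^k`,
takes `η` to `(g, [f_η])_p`. -/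
def alpha {n k : ℕ} (a : Fin n → ℂ) (b : Fin n → Fin k → ℂ) (z : Fin n → ℂ)
    {p : Fin k → ℂ} (hp : p ∈ complement b z) : LocalAlgebra a b z hp →ₗ[ℂ] FlagSpace b z k :=
  (residueForm a b z hp).compl₂
    ((Ideal.Quotient.mkₐ ℂ (Ideal.span (Set.range (gradGerm a b z hp)))).toLinearMap ∘ₗ
      canonicalElement b z hp)

/-- The subspace `Y_p`, the image of `A_{p,Φ}` in `W` under `α_p` followed by `V → W`. -/
def Y {n k : ℕ} (a : Fin n → ℂ) (b : Fin n → Fin k → ℂ) (z : Fin n → ℂ)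
    {p : Fin k → ℂ} (hp : p ∈ complement b z) : Submodule ℂ (W a b z) :=
  LinearMap.range (toW a b z ∘ₗ alpha a b z hp)

end Arrangement

end

/-!
Write `F_i = ∂Φ/∂t_i`, let `A_p` be the local algebra at an isolated critical point `p`, and let
`f_s = symFun b z s` be the coefficient functions of the logarithmic forms. Everything follows from
one formula: under the maps `α_p` the contravariant form on `A_p × A_q` vanishes for `p ≠ q`, and
for `p = q` it is `(-1)^k` times the residue form, which is nondegenerate. Then the images of the
`A_p` are orthogonal and independent and contribute `∑ μ_p` to the rank
(`sum_finrank_le_bilinRank`); since every `μ_p` is positive, there are finitely many points `p`.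

The formula comes from the Bezoutian. Since
`1/f_j(u) - 1/f_j(t) = -(f_j(u) - f_j(t))/(f_j(t) f_j(u))`, the matrix
`M_{il} = -∑_j a_j b_j^i b_j^l / (f_j(t) f_j(u))` satisfies `M (u - t) = F(u) - F(t)`, and the
Cauchy–Binet formula (`Matrix.det_mul_eq_sum_strictMono`) gives
`det M = (-1)^k ∑_s a_{s_1} ⋯ a_{s_k} f_s(t) f_s(u)` (`Arrangement.det_bezoutMatrix`), so that
`S(α_p g, α_q h)` is `(-1)^k` times the residue of `g(t) h(u) det M` in both groups of variables.
Take `t` in `A_p` and expand `u` at `q` in formal power series over `A_p`, where `F(t) = 0`. A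
presentation `u_i^{N+1} = ∑_j c_{ij} F_j(u)`, with coordinates centred at `q`, turns `M` into a
matrix `cM` with `cM (u - t) = (u_i^{N+1})_i`, and the residue in `u` is the coefficient at
`∏ u_i^N` of the product with `det c`.

* If `p ≠ q` then some `t_l - q_l` is invertible in `A_p`, and by Cramer's rule `det(cM)` is zero
  modulo the `u_i^{N+1}` (`HolGerm.ResidueFrame.coeff_det_mul_eq_zero`).
* If `p = q` then, modulo the `u_i^{N+1}`, multiplication of `det(cM)` by `h(u)` agrees with
  multiplication by `h(t)`, and the coefficient of `det(cM)` is `1`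
  (`MonomialPresentation.coeff_det_eq_one`): exchanging one row of `cM` for the row of the diagonal
  solution `∑_m u_i^m t_i^{N-m}` does not change the coefficient, because `u_i - t_i` is not a zero
  divisor modulo the powers of the other variables. Thus pairing `det M` with `h(u)` returns `h(t)`
  (`HolGerm.ResidueFrame.coeff_det_mul_eq`), which gives both the formula and the nondegeneracy of
  the residue form.

That `α_p` takes values in singular vectors is the expansion of a determinant along the row which
sums up to the gradient (`Arrangement.alpha_mem_singFlag`).

The presentation of powers of the coordinates exists by a Nullstellensatz at isolated zeros
(`IsolatedZero.exists_mul_pow_mem`), applied to the numerators of the `F_i`. It amounts to the fact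
that a point of an irreducible affine variety of positive dimension is a limit of other points
(`IsolatedZero.frequently_mem_zeroLocus`), which is proved by Noether normalization: a function that
separates the point from the rest of its fibre has, over nearby base points, a value near zero.
-/

noncomputable section

/-! ### Germs of holomorphic functions: Hadamard's lemma -/

namespace HolGerm

variable {k : ℕ} {p : Fin k → ℂ}

theorem eval_mk (f : (Fin k → ℂ) → ℂ) (hf : AnalyticAt ℂ f p) : eval p (mk f hf) = f p := rfl

theorem mk_mul (f g : (Fin k → ℂ) → ℂ) (hf : AnalyticAt ℂ f p) (hg : AnalyticAt ℂ g p) :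
    mk f hf * mk g hg = mk (f * g) (hf.mul hg) := rfl

theorem mk_sum {ι : Type*} (s : Finset ι) (f : ι → (Fin k → ℂ) → ℂ)
    (hf : ∀ i, AnalyticAt ℂ (f i) p) :
    ∑ i ∈ s, mk (f i) (hf i) =
      mk (fun t => ∑ i ∈ s, f i t) (Finset.analyticAt_fun_sum s fun i _ => hf i) := by
  classical
  induction s using Finset.induction_on with
  | empty => exact (mk_eq_mk (f := fun _ => 0) (hf := analyticAt_const)).2 (by simp)
  | insert i s hi ih =>
    rw [Finset.sum_insert hi, ih]
    exact (mk_eq_mk (f := f i + fun t => ∑ i ∈ s, f i t)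
      (hf := (hf i).add (Finset.analyticAt_fun_sum s fun i _ => hf i))).2
      (Filter.Eventually.of_forall fun t => by simp [Finset.sum_insert hi])

theorem mk_const (c : ℂ) : mk (fun _ => c) analyticAt_const = algebraMap ℂ (HolGerm p) c := rfl

/-- Hadamard's lemma: a holomorphic germ minus its value is a combination of the coordinates. -/
theorem exists_eq_eval_add_sum_coord_mul (φ : HolGerm p) :
    ∃ ψ : Fin k → HolGerm p, φ = algebraMap ℂ _ (eval p φ) + ∑ i, coord p i * ψ i := by
  obtain ⟨f, hf, rfl⟩ := mk_surj φ
  obtain ⟨P, r, hP⟩ := hf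
  have hr : (0 : ENNReal) < P.shift.radius := by
    rw [FormalMultilinearSeries.radius_shift]
    exact hP.r_pos.trans_le hP.r_le
  have hQ := P.shift.hasFPowerSeriesOnBall hr
  have hQ' : HasFPowerSeriesOnBall (fun t => P.shift.sum (t - p)) P.shift p P.shift.radius := by
    simpa using hQ.comp_sub p
  have hA : AnalyticAt ℂ (fun t => P.shift.sum (t - p)) p := hQ'.analyticAt
  have hPP : P.shift.unshift (f p) = P := by
    funext m
    cases m with
    | zero =>
      ext v
      simp only [FormalMultilinearSeries.unshift]
      rw [hP.coeff_zero]
      rfl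
    | succ m => exact ContinuousMultilinearMap.uncurry_curryRight (P (m + 1))
  have hU := hQ'.unshift (z := f p)
  rw [hPP] at hU
  have hev : ∀ᶠ t in 𝓝 p, f t = f p + P.shift.sum (t - p) (t - p) := by
    have h1 := (hP.mono (lt_min hP.r_pos hr) (min_le_left _ _)).unique
      (hU.mono (lt_min hP.r_pos hr) (min_le_right _ _))
    filter_upwards [Metric.eball_mem_nhds p (lt_min hP.r_pos hr)] with t ht
    exact h1 ht
  have hψ : ∀ i, AnalyticAt ℂ (fun t => P.shift.sum (t - p) (Pi.single i 1)) p := fun i =>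
    (ContinuousLinearMap.analyticAt
      (ContinuousLinearMap.apply ℂ ℂ (Pi.single i (1 : ℂ) : Fin k → ℂ)) _).fun_comp hA
  refine ⟨fun i => mk _ (hψ i), ?_⟩
  simp only [coord, mk_mul]
  rw [mk_sum, ← mk_const]
  refine (mk_eq_mk (hg := analyticAt_const.add (Finset.analyticAt_fun_sum _ fun i _ =>
    ((analyticAt_apply p i).fun_sub analyticAt_const).mul (hψ i)))).2 ?_
  filter_upwards [hev] with t ht
  rw [ht]
  simp only [Pi.add_apply, Pi.mul_apply, add_right_inj]
  conv_lhs => rw [show P.shift.sum (t - p) (t - p) = P.shift.sum (t - p)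
    (∑ i, (t - p) i • Pi.single i 1) from congrArg _ (pi_eq_sum_univ' (t - p)), map_sum]
  simp

theorem eval_eq_zero_of_mem_span_coord {φ : HolGerm p}
    (h : φ ∈ Ideal.span (Set.range (coord p))) : eval p φ = 0 := by
  have : Ideal.span (Set.range (coord p)) ≤ RingHom.ker (eval p) := by
    rw [Ideal.span_le]
    rintro _ ⟨i, rfl⟩
    exact eval_coord p i
  exact this h

/-- Every germ is congruent to a polynomial modulo any power of the maximal ideal. -/
theorem exists_sub_aeval_mem_pow (M : ℕ) (φ : HolGerm p) :
    ∃ q : MvPolynomial (Fin k) ℂ,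
      φ - MvPolynomial.aeval (coord p) q ∈ Ideal.span (Set.range (coord p)) ^ M := by
  induction M generalizing φ with
  | zero => exact ⟨0, by simp⟩
  | succ M ih =>
    obtain ⟨ψ, hψ⟩ := exists_eq_eval_add_sum_coord_mul φ
    choose q hq using fun i => ih (ψ i)
    refine ⟨MvPolynomial.C (eval p φ) + ∑ i, MvPolynomial.X i * q i, ?_⟩
    have : φ - MvPolynomial.aeval (coord p)
        (MvPolynomial.C (eval p φ) + ∑ i, MvPolynomial.X i * q i) =
        ∑ i, coord p i * (ψ i - MvPolynomial.aeval (coord p) (q i)) := by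
      rw [map_add, MvPolynomial.algHom_C]
      nth_rewrite 1 [hψ]
      simp only [map_sum, map_mul, MvPolynomial.aeval_X, mul_sub, Finset.sum_sub_distrib]
      ring
    rw [this, pow_succ']
    exact Ideal.sum_mem _ fun i _ => Ideal.mul_mem_mul (Ideal.subset_span ⟨i, rfl⟩) (hq i)

/-! ### Taylor expansions of germs -/

theorem derivation_mem_pow {R : Type*} [CommRing R] [Algebra ℂ R] (D : Derivation ℂ R R)
    (I : Ideal R) (m : ℕ) {x : R} (hx : x ∈ I ^ (m + 1)) : D x ∈ I ^ m := by
  induction m generalizing x with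
  | zero => simp
  | succ m ih =>
    rw [pow_succ] at hx
    induction hx using Submodule.mul_induction_on' with
    | mem_mul_mem y hy w hw =>
      rw [Derivation.leibniz, smul_eq_mul, smul_eq_mul]
      refine Ideal.add_mem _ (Ideal.mul_mem_right _ _ hy) ?_
      rw [pow_succ']
      exact Ideal.mul_mem_mul hw (ih hy)
    | add y _ w _ h1 h2 => rw [map_add]; exact Ideal.add_mem _ h1 h2

theorem derivation_pow_mem_pow {R : Type*} [CommRing R] [Algebra ℂ R] (D : Derivation ℂ R R)
    (I : Ideal R) (m r : ℕ) {x : R} (hx : x ∈ I ^ (m + r)) :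
    (D.toLinearMap ^ r) x ∈ I ^ m := by
  induction r generalizing m with
  | zero => simpa using hx
  | succ r ih =>
    rw [pow_succ']
    exact derivation_mem_pow D I m (ih (m + 1) (by rwa [show m + 1 + r = m + (r + 1) by ring]))

/-- Taylor coefficients of total degree at most `d` vanish on the `(d+1)`-st power of the maximal
ideal. -/
theorem coeff_eq_zero_of_mem_pow (α : Fin k → ℕ) {φ : HolGerm p}
    (hφ : φ ∈ Ideal.span (Set.range (coord p)) ^ (∑ i, α i + 1)) : coeff p α φ = 0 := by
  have key : ∀ (l : List (Fin k)) (m : ℕ),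
      φ ∈ Ideal.span (Set.range (coord p)) ^ (m + (l.map α).sum) →
      (l.map fun j => (pderiv p j).toLinearMap ^ α j).prod φ ∈
        Ideal.span (Set.range (coord p)) ^ m := by
    intro l
    induction l with
    | nil => intro m h; simpa using h
    | cons j l ih =>
      intro m h
      rw [List.map_cons, List.prod_cons, Module.End.mul_apply]
      refine derivation_pow_mem_pow _ _ _ _ (ih _ ?_)
      rwa [List.map_cons, List.sum_cons, ← add_assoc] at h
  have h := key (List.finRange k) 1 (by
    rwa [← List.ofFn_eq_map, List.sum_ofFn, add_comm])
  rw [pow_one] at h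
  have h' : eval p (iteratedPderiv p α φ) = 0 := eval_eq_zero_of_mem_span_coord h
  simp [coeff, h']

theorem pderiv_coord_self (i : Fin k) : pderiv p i (coord p i) = 1 := by
  rw [coord, pderiv_mk]
  change _ = mk (fun _ => 1) analyticAt_const
  rw [mk_eq_mk]
  refine Filter.Eventually.of_forall fun t => ?_
  have : HasFDerivAt (fun t : Fin k → ℂ => t i - p i)
      (ContinuousLinearMap.proj (R := ℂ) (φ := fun _ : Fin k => ℂ) i) t :=
    (hasFDerivAt_apply i t).sub_const _
  rw [this.fderiv]
  simp

theorem pderiv_aeval (i : Fin k) (q : MvPolynomial (Fin k) ℂ) :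
    pderiv p i (MvPolynomial.aeval (coord p) q) =
      MvPolynomial.aeval (coord p) (MvPolynomial.pderiv i q) := by
  induction q using MvPolynomial.induction_on with
  | C c =>
    rw [MvPolynomial.pderiv_C, map_zero, MvPolynomial.algHom_C, Derivation.map_algebraMap]
  | add q r hq hr => simp [hq, hr]
  | mul_X q j hq =>
    rw [map_mul, Derivation.leibniz, Derivation.leibniz, hq, MvPolynomial.aeval_X]
    rcases eq_or_ne j i with rfl | h
    · simp [pderiv_coord_self]
    · simp [pderiv_coord_of_ne p h.symm, MvPolynomial.pderiv_X_of_ne h]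

theorem coeff_pderiv_pow (i : Fin k) (r : ℕ) (q : MvPolynomial (Fin k) ℂ) (β : Fin k →₀ ℕ)
    (hβ : β i = 0) :
    MvPolynomial.coeff β (((MvPolynomial.pderiv i).toLinearMap ^ r) q) =
      (r.factorial : ℂ) * MvPolynomial.coeff (β + Finsupp.single i r) q := by
  induction r generalizing q with
  | zero => simp
  | succ r ih =>
    rw [pow_succ, Module.End.mul_apply, ih]
    change _ * MvPolynomial.coeff _ (MvPolynomial.pderiv i q) = _
    rw [MvPolynomial.coeff_pderiv, add_assoc, ← Finsupp.single_add, Nat.factorial_succ]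
    simp [hβ]
    ring

/-- On polynomials in the coordinates the Taylor coefficients are the coefficients. -/
theorem coeff_aeval (α : Fin k →₀ ℕ) (q : MvPolynomial (Fin k) ℂ) :
    coeff p α (MvPolynomial.aeval (coord p) q) = MvPolynomial.coeff α q := by
  have h1 : ∀ (i : Fin k) (r : ℕ) (q : MvPolynomial (Fin k) ℂ),
      ((pderiv p i).toLinearMap ^ r) (MvPolynomial.aeval (coord p) q) =
        MvPolynomial.aeval (coord p) (((MvPolynomial.pderiv i).toLinearMap ^ r) q) := by
    intro i r
    induction r with
    | zero => simp
    | succ r ih =>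
      intro q
      rw [pow_succ, pow_succ, Module.End.mul_apply, Module.End.mul_apply]
      exact (congrArg _ (pderiv_aeval i q)).trans (ih _)
  have h2 : ∀ l : List (Fin k), l.Nodup →
      (l.map fun j => (pderiv p j).toLinearMap ^ α j).prod (MvPolynomial.aeval (coord p) q) =
        MvPolynomial.aeval (coord p)
          ((l.map fun j => (MvPolynomial.pderiv (R := ℂ) j).toLinearMap ^ α j).prod q) ∧
      ∀ β : Fin k →₀ ℕ, (∀ i ∈ l, β i = 0) →
        MvPolynomial.coeff β
            ((l.map fun j => (MvPolynomial.pderiv (R := ℂ) j).toLinearMap ^ α j).prod q) =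
          (l.map fun i => ((α i).factorial : ℂ)).prod *
            MvPolynomial.coeff (β + (l.map fun i => Finsupp.single i (α i)).sum) q := by
    intro l
    induction l with
    | nil => intro _; simp
    | cons j l ih =>
      intro hl
      rw [List.nodup_cons] at hl
      obtain ⟨ih1, ih2⟩ := ih hl.2
      refine ⟨?_, fun β hβ => ?_⟩
      · rw [List.map_cons, List.prod_cons, Module.End.mul_apply, ih1, h1]
        rfl
      · rw [List.map_cons, List.prod_cons, Module.End.mul_apply,
          coeff_pderiv_pow _ _ _ _ (hβ j List.mem_cons_self), ih2]
        · simp [mul_assoc, add_assoc]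
        · intro i hi
          have hij : j ≠ i := fun h => hl.1 (h ▸ hi)
          simp [hβ i (List.mem_cons_of_mem _ hi), hij]
  obtain ⟨h3, h4⟩ := h2 (List.finRange k) (List.nodup_finRange k)
  have h5 : ∀ r : MvPolynomial (Fin k) ℂ,
      eval p (MvPolynomial.aeval (coord p) r) = MvPolynomial.coeff 0 r := by
    intro r
    rw [← AlgHom.comp_apply, MvPolynomial.comp_aeval]
    simp only [eval_coord]
    simp [MvPolynomial.aeval_def, MvPolynomial.constantCoeff_eq]
  have h6 : (∏ i, ((α i).factorial : ℂ)) ≠ 0 :=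
    Finset.prod_ne_zero_iff.2 fun i _ => Nat.cast_ne_zero.2 (Nat.factorial_ne_zero _)
  have h7 : iteratedPderiv p α (MvPolynomial.aeval (coord p) q) = _ := h3
  rw [coeff, LinearMap.smul_apply, LinearMap.comp_apply, h7]
  change _ • eval p _ = _
  rw [h5, h4 0 (fun _ _ => rfl), ← List.ofFn_eq_map, List.prod_ofFn, ← List.ofFn_eq_map,
    List.sum_ofFn, zero_add, Finsupp.univ_sum_single, smul_eq_mul, inv_mul_cancel_left₀ h6]

/-- The Taylor expansion of a germ, as a homomorphism to formal power series. -/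
def taylor (p : Fin k → ℂ) : HolGerm p →ₐ[ℂ] MvPowerSeries (Fin k) ℂ :=
  AlgHom.ofLinearMap
    (LinearMap.pi fun α : Fin k →₀ ℕ => coeff p α)
    (by
      funext α
      have h := coeff_aeval (p := p) α 1
      rw [map_one] at h
      refine h.trans ?_
      classical
      exact (MvPolynomial.coeff_one α).trans (by
        rw [← MvPowerSeries.coeff_apply (R := ℂ) 1 α, MvPowerSeries.coeff_one]; simp [eq_comm]))
    (by
      intro φ ψ
      classical
      funext α
      set I := Ideal.span (Set.range (coord p))
      -- Modulo a high power of the maximal ideal the factors are polynomials.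
      obtain ⟨q, hq⟩ := exists_sub_aeval_mem_pow (∑ i, α i + 1) φ
      obtain ⟨r, hr⟩ := exists_sub_aeval_mem_pow (∑ i, α i + 1) ψ
      have hlow : ∀ β : Fin k →₀ ℕ, β ≤ α → ∀ (χ : HolGerm p) (s : MvPolynomial (Fin k) ℂ),
          χ - MvPolynomial.aeval (coord p) s ∈ I ^ (∑ i, α i + 1) →
          coeff p β χ = MvPolynomial.coeff β s := by
        intro β hβ χ s h
        have h' := coeff_eq_zero_of_mem_pow (p := p) β (Ideal.pow_le_pow_right
          (Nat.succ_le_succ (Finset.sum_le_sum fun i _ => hβ i)) h)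
        rwa [map_sub, coeff_aeval, sub_eq_zero] at h'
      have hprod : φ * ψ - MvPolynomial.aeval (coord p) (q * r) ∈ I ^ (∑ i, α i + 1) := by
        rw [map_mul, show φ * ψ - MvPolynomial.aeval (coord p) q * MvPolynomial.aeval (coord p) r =
          (φ - MvPolynomial.aeval (coord p) q) * ψ +
            MvPolynomial.aeval (coord p) q * (ψ - MvPolynomial.aeval (coord p) r) by ring]
        exact Ideal.add_mem _ (Ideal.mul_mem_right _ _ hq) (Ideal.mul_mem_left _ _ hr)
      change coeff p α (φ * ψ) = _
      rw [hlow α le_rfl _ _ hprod, MvPolynomial.coeff_mul]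
      refine Eq.trans ?_ (MvPowerSeries.coeff_mul (R := ℂ) α _ _).symm
      refine Finset.sum_congr rfl fun x hx => ?_
      have hx' := Finset.HasAntidiagonal.mem_antidiagonal.1 hx
      rw [← hlow x.1 (hx' ▸ le_self_add) _ _ hq, ← hlow x.2 (hx' ▸ le_add_self) _ _ hr]
      rfl)

theorem coeff_taylor (α : Fin k →₀ ℕ) (φ : HolGerm p) :
    MvPowerSeries.coeff α (taylor p φ) = coeff p α φ := rfl

theorem taylor_coord (i : Fin k) : taylor p (coord p i) = MvPowerSeries.X i := by
  classical
  ext α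
  have h := coeff_aeval (p := p) α (MvPolynomial.X i)
  rw [MvPolynomial.aeval_X] at h
  rw [coeff_taylor, h, MvPolynomial.coeff_X, MvPowerSeries.coeff_X]
  simp [eq_comm]

/-! ### Quotients of the algebra of germs -/

theorem ResidueFrame.exists_pow_le {F : Fin k → HolGerm p} (D : ResidueFrame F) :
    ∃ M : ℕ, Ideal.span (Set.range (coord p)) ^ M ≤
      Ideal.span (Set.range fun i => coord p i ^ (D.N + 1)) := by
  refine Ideal.exists_pow_le_of_le_radical_of_fg (Ideal.span_le.2 ?_)
    ((Submodule.fg_def).2 ⟨_, Set.finite_range _, rfl⟩)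
  rintro _ ⟨i, rfl⟩
  exact ⟨D.N + 1, Ideal.subset_span ⟨i, rfl⟩⟩

theorem ResidueFrame.coord_pow_mem {F : Fin k → HolGerm p} (D : ResidueFrame F) (i : Fin k) :
    coord p i ^ (D.N + 1) ∈ Ideal.span (Set.range F) := by
  rw [D.pow_eq]
  exact Ideal.sum_mem _ fun j _ => Ideal.mul_mem_left _ _ (Ideal.subset_span ⟨j, rfl⟩)

/-- If the ideal contains powers of the coordinates, the quotient is generated by nilpotent
elements, hence finite-dimensional. -/
theorem ResidueFrame.finite {F : Fin k → HolGerm p} (D : ResidueFrame F) :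
    Module.Finite ℂ (HolGerm p ⧸ Ideal.span (Set.range F)) := by
  obtain ⟨M, hM⟩ := D.exists_pow_le
  have hG : Ideal.span (Set.range fun i => coord p i ^ (D.N + 1)) ≤ Ideal.span (Set.range F) := by
    rw [Ideal.span_le]
    rintro _ ⟨i, rfl⟩
    exact D.coord_pow_mem i
  let g : MvPolynomial (Fin k) ℂ →ₐ[ℂ] HolGerm p ⧸ Ideal.span (Set.range F) :=
    (Ideal.Quotient.mkₐ ℂ _).comp (MvPolynomial.aeval (coord p))
  have hg : Function.Surjective g := by
    intro x
    obtain ⟨φ, rfl⟩ := Ideal.Quotient.mk_surjective x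
    obtain ⟨q, hq⟩ := exists_sub_aeval_mem_pow M φ
    exact ⟨q, (Ideal.Quotient.eq.2 (hG (hM hq))).symm⟩
  have hft : Algebra.FiniteType ℂ (HolGerm p ⧸ Ideal.span (Set.range F)) :=
    Algebra.FiniteType.of_surjective g hg
  have hint : Algebra.IsIntegral ℂ (HolGerm p ⧸ Ideal.span (Set.range F)) := by
    refine ⟨fun x => ?_⟩
    obtain ⟨q, rfl⟩ := hg x
    induction q using MvPolynomial.induction_on with
    | C c => rw [MvPolynomial.algHom_C]; exact isIntegral_algebraMap
    | add q r hq hr => rw [map_add]; exact hq.add hr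
    | mul_X q i hq =>
      rw [map_mul]
      refine hq.mul ?_
      have h0 : g (MvPolynomial.X i) ^ (D.N + 1) = 0 := by
        rw [← map_pow]
        refine Ideal.Quotient.eq_zero_iff_mem.2 ?_
        rw [RingHom.coe_coe, map_pow, MvPolynomial.aeval_X]
        exact D.coord_pow_mem i
      exact IsIntegral.of_pow (Nat.succ_pos _) (h0 ▸ isIntegral_zero)
  exact Algebra.IsIntegral.finite

theorem residue_mk {F : Fin k → HolGerm p} (h : Nonempty (ResidueFrame F)) (φ : HolGerm p) :
    residue F (Ideal.Quotient.mk _ φ) = h.some.functional φ := by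
  have h1 : residue F = ((Ideal.span (Set.range F)).restrictScalars ℂ).liftQ h.some.functional
      (fun _ hφ => h.some.functional_eq_zero hφ) := dif_pos h
  rw [h1]
  rfl

end HolGerm

/-! ### Isolated zeros of polynomial systems -/

namespace IsolatedZero

open MvPolynomial

/-- A polynomial that is `1` at a point and `0` at finitely many others. -/
theorem exists_separating {k : ℕ} (K : Finset (Fin k → ℂ)) (p : Fin k → ℂ) (hp : p ∉ K) :
    ∃ e : MvPolynomial (Fin k) ℂ, eval p e = 1 ∧ ∀ x ∈ K, eval x e = 0 := by
  have h : ∀ x : Fin k → ℂ, ∃ e : MvPolynomial (Fin k) ℂ, x ∈ K → eval p e = 1 ∧ eval x e = 0 := by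
    intro x
    by_cases hx : x ∈ K
    · have hne : x ≠ p := fun h => hp (h ▸ hx)
      obtain ⟨i, hi⟩ := Function.ne_iff.1 hne
      refine ⟨C ((p i - x i)⁻¹) * (X i - C (x i)), fun _ => ⟨?_, ?_⟩⟩
      · simp [inv_mul_cancel₀ (sub_ne_zero.2 hi.symm)]
      · simp
    · exact ⟨0, fun h => absurd h hx⟩
  choose e he using h
  refine ⟨∏ x ∈ K, e x, ?_, fun x hx => ?_⟩
  · rw [map_prod]
    exact Finset.prod_eq_one fun x hx => (he x hx).1
  · rw [map_prod]
    exact Finset.prod_eq_zero hx (he x hx).2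

/-- A monic complex polynomial has a root bounded by its constant coefficient. -/
theorem exists_root_norm_pow_le (f : Polynomial ℂ) (hf : f.Monic) (hd : f.natDegree ≠ 0) :
    ∃ r, f.eval r = 0 ∧ ‖r‖ ^ f.natDegree ≤ ‖f.coeff 0‖ := by
  have hs := IsAlgClosed.splits f
  have hcard : f.roots.card = f.natDegree := hs.natDegree_eq_card_roots.symm
  have hne : f.roots.toFinset.Nonempty := by
    rw [Multiset.toFinset_nonempty]
    intro h
    rw [h, Multiset.card_zero] at hcard
    exact hd hcard.symm
  obtain ⟨r, hr, hmin⟩ := f.roots.toFinset.exists_min_image (fun r => ‖r‖) hne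
  refine ⟨r, (Polynomial.mem_roots'.1 (Multiset.mem_toFinset.1 hr)).2, ?_⟩
  have key : ∀ s : Multiset ℂ, (∀ x ∈ s, ‖r‖ ≤ ‖x‖) → ‖r‖ ^ s.card ≤ ‖s.prod‖ := by
    intro s
    induction s using Multiset.induction_on with
    | empty => simp
    | cons x s ih =>
      intro h
      rw [Multiset.card_cons, Multiset.prod_cons, norm_mul, pow_succ']
      exact mul_le_mul (h x (Multiset.mem_cons_self x s))
        (ih fun y hy => h y (Multiset.mem_cons_of_mem hy)) (by positivity) (norm_nonneg _)
  have h := key f.roots fun x hx => hmin x (Multiset.mem_toFinset.2 hx)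
  rw [hcard] at h
  rw [hs.coeff_zero_eq_prod_roots_of_monic hf]
  simpa using h

theorem norm_root_le (f : Polynomial ℂ) (hf : f.Monic) (r : ℂ) (hr : f.eval r = 0) :
    ‖r‖ ≤ 1 + ∑ j ∈ Finset.range f.natDegree, ‖f.coeff j‖ := by
  have hS : 0 ≤ ∑ j ∈ Finset.range f.natDegree, ‖f.coeff j‖ :=
    Finset.sum_nonneg fun _ _ => norm_nonneg _
  rcases le_or_gt ‖r‖ 1 with h1 | h1
  · linarith
  have h0 : f.natDegree ≠ 0 := by
    intro h
    rw [Polynomial.eq_one_of_monic_natDegree_zero hf h] at hr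
    simp at hr
  obtain ⟨d, hd⟩ := Nat.exists_eq_succ_of_ne_zero h0
  rw [Polynomial.eval_eq_sum_range, Finset.sum_range_succ, hf.coeff_natDegree, one_mul] at hr
  have h2 : ‖r‖ ^ (d + 1) ≤ (∑ j ∈ Finset.range f.natDegree, ‖f.coeff j‖) * ‖r‖ ^ d := by
    rw [← norm_pow, ← Nat.succ_eq_add_one, ← hd, eq_neg_of_add_eq_zero_right hr, norm_neg,
      Finset.sum_mul]
    refine (norm_sum_le _ _).trans (Finset.sum_le_sum fun j hj => ?_)
    rw [norm_mul, norm_pow]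
    refine mul_le_mul_of_nonneg_left (pow_le_pow_right₀ h1.le ?_) (norm_nonneg _)
    have := Finset.mem_range.1 hj
    omega
  rw [pow_succ'] at h2
  have := le_of_mul_le_mul_right h2 (by positivity)
  linarith

theorem minpoly_coeff_zero_ne_zero {A R : Type*} [CommRing A] [CommRing R] [IsDomain R]
    [Algebra A R]
    {y : R} (hy : IsIntegral A y) (h0 : y ≠ 0) : (minpoly A y).coeff 0 ≠ 0 := by
  intro h
  have : Nontrivial A := (algebraMap A R).domain_nontrivial
  obtain ⟨f, hf⟩ := Polynomial.X_dvd_iff.2 h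
  have hmon : f.Monic := by
    refine Polynomial.Monic.of_mul_monic_left Polynomial.monic_X ?_
    rw [← hf]
    exact minpoly.monic hy
  have h1 := minpoly.aeval A y
  rw [hf, map_mul, Polynomial.aeval_X] at h1
  have h2 := minpoly.min A y hmon ((mul_eq_zero.1 h1).resolve_left h0)
  rw [hf, Polynomial.X_mul, Polynomial.degree_mul_X,
    Polynomial.degree_eq_natDegree hmon.ne_zero] at h2
  have h3 : f.natDegree + 1 ≤ f.natDegree := by exact_mod_cast h2
  omega

/-- Points of an integral extension of a polynomial ring with a prescribed image and a prescribed
value `r` of one function `ℓ`: every root `r` of the specialised minimal polynomial occurs. -/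
theorem exists_algHom_of_root {s : ℕ} {R : Type} [CommRing R] [IsDomain R] [Algebra ℂ R]
    [Algebra.FiniteType ℂ R] (g : MvPolynomial (Fin s) ℂ →ₐ[ℂ] R) (hinj : Function.Injective g)
    (hint : g.IsIntegral) (l : R) (c : Fin s → ℂ) (r : ℂ)
    (hr : letI := g.toAlgebra
      ((minpoly (MvPolynomial (Fin s) ℂ) l).map (eval c)).eval r = 0) :
    ∃ χ : R →ₐ[ℂ] ℂ, (∀ a, χ (g a) = eval c a) ∧ χ l = r := by
  let := g.toAlgebra
  have : IsScalarTower ℂ (MvPolynomial (Fin s) ℂ) R := IsScalarTower.of_algebraMap_eq' (by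
    ext x
    exact (g.commutes x).symm)
  have : Algebra.IsIntegral (MvPolynomial (Fin s) ℂ) R := ⟨hint⟩
  have : FaithfulSMul (MvPolynomial (Fin s) ℂ) R :=
    (faithfulSMul_iff_algebraMap_injective _ _).2 hinj
  have hl : IsIntegral (MvPolynomial (Fin s) ℂ) l := Algebra.IsIntegral.isIntegral l
  have hr' : Polynomial.eval₂ (eval c) r (minpoly (MvPolynomial (Fin s) ℂ) l) = 0 := by
    rwa [Polynomial.eval_map] at hr
  let S := Algebra.adjoin (MvPolynomial (Fin s) ℂ) ({l} : Set R)
  let ψ : S →+* ℂ := (AdjoinRoot.lift (eval c) r hr').comp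
    (minpoly.equivAdjoin hl).symm.toRingEquiv.toRingHom
  have hψ : ∀ a : MvPolynomial (Fin s) ℂ, ψ (algebraMap _ S a) = eval c a := by
    intro a
    change AdjoinRoot.lift (eval c) r hr' ((minpoly.equivAdjoin hl).symm (algebraMap _ _ a)) = _
    rw [AlgEquiv.commutes]
    exact AdjoinRoot.lift_of hr'
  have hψl : ψ ⟨l, Algebra.subset_adjoin rfl⟩ = r := by
    have h1 : (minpoly.equivAdjoin hl).symm ⟨l, Algebra.subset_adjoin rfl⟩ =
        AdjoinRoot.root (minpoly (MvPolynomial (Fin s) ℂ) l) := by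
      rw [AlgEquiv.symm_apply_eq]
      simp [AdjoinRoot.Minpoly.toAdjoin, minpoly.coe_equivAdjoin]
    change AdjoinRoot.lift (eval c) r hr' ((minpoly.equivAdjoin hl).symm _) = _
    rw [h1]
    exact AdjoinRoot.lift_root hr'
  have hsurj : Function.Surjective ψ := fun w =>
    ⟨algebraMap (MvPolynomial (Fin s) ℂ) S (C w), by rw [hψ, eval_C]⟩
  have : (RingHom.ker ψ).IsMaximal := RingHom.ker_isMaximal_of_surjective ψ hsurj
  have : Algebra.IsIntegral S R := Algebra.IsIntegral.tower_top (MvPolynomial (Fin s) ℂ)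
  obtain ⟨Q, hQ, hQc⟩ := Ideal.exists_ideal_over_maximal_of_isIntegral (S := R) (RingHom.ker ψ)
    (by
      rw [(RingHom.injective_iff_ker_eq_bot _).1 (show Function.Injective (algebraMap S R) from
        Subtype.val_injective)]
      exact bot_le)
  let : Field (R ⧸ Q) := Ideal.Quotient.field Q
  have : Module.Finite ℂ (R ⧸ Q) := finite_of_finite_type_of_isJacobsonRing ℂ (R ⧸ Q)
  let e : ℂ ≃ₐ[ℂ] (R ⧸ Q) := AlgEquiv.ofBijective (Algebra.ofId ℂ (R ⧸ Q))
    (IsAlgClosed.algebraMap_bijective_of_isIntegral)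
  let χ : R →ₐ[ℂ] ℂ := e.symm.toAlgHom.comp (Ideal.Quotient.mkₐ ℂ Q)
  have hχ : ∀ x : S, χ x = ψ x := by
    intro x
    have h1 : x - algebraMap (MvPolynomial (Fin s) ℂ) S (C (ψ x)) ∈ RingHom.ker ψ := by
      rw [RingHom.mem_ker, map_sub, hψ, eval_C, sub_self]
    rw [← hQc, Ideal.mem_comap, map_sub] at h1
    have h2 : χ (algebraMap S R x -
        algebraMap S R (algebraMap (MvPolynomial (Fin s) ℂ) S (C (ψ x)))) = 0 := by
      change e.symm (Ideal.Quotient.mk Q _) = 0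
      rw [Ideal.Quotient.eq_zero_iff_mem.2 h1, map_zero]
    rw [map_sub, sub_eq_zero] at h2
    refine h2.trans ?_
    have h3 : algebraMap S R (algebraMap (MvPolynomial (Fin s) ℂ) S (C (ψ x))) =
        algebraMap ℂ R (ψ x) := by
      rw [← IsScalarTower.algebraMap_apply, ← MvPolynomial.algebraMap_eq,
        ← IsScalarTower.algebraMap_apply]
    rw [h3, AlgHom.commutes]
    rfl
  refine ⟨χ, fun a => ?_, ?_⟩
  · rw [← hψ, ← hχ]; rfl
  · rw [← hψl, ← hχ]

/-- A point of an irreducible affine variety that is not the whole variety is a limit of other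
points of the variety. -/
theorem frequently_mem_zeroLocus {k : ℕ} (q : Ideal (MvPolynomial (Fin k) ℂ)) [hq : q.IsPrime]
    (p : Fin k → ℂ) (hp : ∀ P ∈ q, eval p P = 0) (x : MvPolynomial (Fin k) ℂ)
    (hx : eval p x = 0) (hxq : x ∉ q) : ∃ᶠ t in 𝓝[≠] p, ∀ P ∈ q, eval t P = 0 := by
  classical
  let R := MvPolynomial (Fin k) ℂ ⧸ q
  let π : MvPolynomial (Fin k) ℂ →ₐ[ℂ] R := Ideal.Quotient.mkₐ ℂ q
  have hπ : Function.Surjective π := Ideal.Quotient.mk_surjective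
  obtain ⟨s, -, g, hinj, hint⟩ := exists_integral_inj_algHom_of_quotient q hq.ne_top
  let _ := g.toAlgebra
  let A := MvPolynomial (Fin s) ℂ
  have hAint : ∀ y : R, IsIntegral A y := hint
  -- The finite projection to affine space is given by polynomials.
  choose Yp hYp using fun j => hπ (g (X j))
  let proj : (Fin k → ℂ) → (Fin s → ℂ) := fun t j => eval t (Yp j)
  have hχ : ∀ t : Fin k → ℂ, (∀ P ∈ q, eval t P = 0) →
      ∃ χ : R →ₐ[ℂ] ℂ, (∀ P, χ (π P) = eval t P) ∧ ∀ a, χ (g a) = eval (proj t) a := by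
    intro t ht
    let χ : R →ₐ[ℂ] ℂ := Ideal.Quotient.liftₐ q (aeval t) ht
    have h1 : ∀ P, χ (π P) = eval t P := fun P => rfl
    refine ⟨χ, h1, fun a => ?_⟩
    have h2 : (χ.comp g) = aeval (proj t) := by
      ext j
      rw [aeval_X, AlgHom.comp_apply, ← hYp, h1]
    exact (AlgHom.congr_fun h2 a)
  -- The integral equation of a function specialises at every point of the variety.
  have hroot : ∀ t : Fin k → ℂ, (∀ P ∈ q, eval t P = 0) → ∀ P : MvPolynomial (Fin k) ℂ,
      ((minpoly A (π P)).map (eval (proj t))).eval (eval t P) = 0 := by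
    intro t ht P
    obtain ⟨χ, h1, h2⟩ := hχ t ht
    have h3 := congrArg χ (minpoly.aeval A (π P))
    rw [map_zero, Polynomial.aeval_def, ← RingHom.coe_coe χ, Polynomial.hom_eval₂] at h3
    rw [Polynomial.eval_map, ← h1]
    rw [show ((χ : R →+* ℂ).comp (algebraMap A R)) = eval (proj t) from RingHom.ext h2] at h3
    exact h3
  have hmonic : ∀ (y : R) (c : Fin s → ℂ), ((minpoly A y).map (eval c)).Monic := fun y c =>
    (minpoly.monic (hAint y)).map _
  have hdeg : ∀ (y : R) (c : Fin s → ℂ),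
      ((minpoly A y).map (eval c)).natDegree = (minpoly A y).natDegree := fun y c =>
    (minpoly.monic (hAint y)).natDegree_map _
  -- The base has positive dimension: otherwise the constant coefficient of the minimal polynomial
  -- of `x` would be a nonzero constant vanishing at `p`.
  have hs : Nonempty (Fin s) := by
    by_contra hempty
    rw [not_nonempty_iff] at hempty
    have hx0 : π x ≠ 0 := fun h => hxq (Ideal.Quotient.eq_zero_iff_mem.1 h)
    have h1 := minpoly_coeff_zero_ne_zero (hAint (π x)) hx0
    have h2 := hroot p hp x
    rw [hx, ← Polynomial.coeff_zero_eq_eval_zero, Polynomial.coeff_map] at h2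
    rw [MvPolynomial.eq_C_of_isEmpty (Polynomial.coeff (minpoly A (π x)) 0), eval_C] at h2
    exact h1 (by rw [MvPolynomial.eq_C_of_isEmpty (Polynomial.coeff (minpoly A (π x)) 0), h2, C_0])
  obtain ⟨j₀⟩ := hs
  -- `K` contains the other points of the fibre through `p`; `l` is `0` at `p` and `1` on `K`.
  let K : Finset (Fin k → ℂ) := (Fintype.piFinset fun i =>
    ((minpoly A (π (X i))).map (eval (proj p))).roots.toFinset).erase p
  obtain ⟨e, hep, heK⟩ := exists_separating K p (Finset.notMem_erase _ _)
  let l : MvPolynomial (Fin k) ℂ := 1 - e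
  let c : ℕ → Fin s → ℂ := fun m => proj p + (1 / ((m : ℂ) + 1)) • Pi.single j₀ 1
  have hc : Filter.Tendsto c Filter.atTop (𝓝 (proj p)) := by
    have h1 : Filter.Tendsto (fun m : ℕ => (1 / ((m : ℂ) + 1))) Filter.atTop (𝓝 0) :=
      tendsto_one_div_add_atTop_nhds_zero_nat
    have h2 := (tendsto_const_nhds (x := proj p)).add (h1.smul_const
      (Pi.single j₀ (1 : ℂ) : Fin s → ℂ))
    rwa [zero_smul, add_zero] at h2
  have hcne : ∀ m, c m ≠ proj p := by
    intro m h
    have h1 := congrFun h j₀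
    have h2 : ((m : ℂ) + 1) ≠ 0 := Nat.cast_add_one_ne_zero m
    simp [c, h2] at h1
  have hcc : ∀ a : A, Filter.Tendsto (fun m => eval (c m) a) Filter.atTop
      (𝓝 (eval (proj p) a)) := fun a =>
    ((MvPolynomial.continuous_eval a).tendsto _).comp hc
  have hd0 : (minpoly A (π l)).natDegree ≠ 0 := (minpoly.natDegree_pos (hAint _)).ne'
  have hex : ∀ m, ∃ t : Fin k → ℂ, (∀ P ∈ q, eval t P = 0) ∧ proj t = c m ∧
      ‖eval t l‖ ^ (minpoly A (π l)).natDegree ≤ ‖eval (c m) ((minpoly A (π l)).coeff 0)‖ := by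
    intro m
    obtain ⟨r, hr, hr'⟩ := exists_root_norm_pow_le _ (hmonic (π l) (c m)) (by rwa [hdeg])
    obtain ⟨χ, h1, h2⟩ := exists_algHom_of_root g hinj hint (π l) (c m) r hr
    have h3 : ∀ P, eval (fun i => χ (π (X i))) P = χ (π P) := by
      intro P
      have : (χ.comp π) = aeval fun i => χ (π (X i)) := by
        ext j
        rw [aeval_X, AlgHom.comp_apply]
      exact (AlgHom.congr_fun this P).symm
    refine ⟨fun i => χ (π (X i)), fun P hP => ?_, ?_, ?_⟩
    · rw [h3, show π P = 0 from Ideal.Quotient.eq_zero_iff_mem.2 hP, map_zero]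
    · funext j
      change eval _ (Yp j) = _
      rw [h3, hYp, h1, eval_X]
    · rw [h3, h2, ← Polynomial.coeff_map, ← hdeg (π l) (c m)]
      exact hr'
  -- The points `t m` lie over `c m ≠ proj p`, with `l (t m)` tending to `0`; they are bounded, and
  -- a limit point lies in the fibre through `p` and is a zero of `l`, so it is `p`.
  choose t htq htc htl using hex
  have hlim : Filter.Tendsto (fun m => ‖eval (t m) l‖) Filter.atTop (𝓝 0) := by
    have h0 : eval (proj p) ((minpoly A (π l)).coeff 0) = 0 := by
      have h2 := hroot p hp l
      have h3 : eval p l = 0 := by simp [l, hep]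
      rwa [h3, ← Polynomial.coeff_zero_eq_eval_zero, Polynomial.coeff_map] at h2
    have h1 := (hcc ((minpoly A (π l)).coeff 0)).norm
    rw [h0, norm_zero] at h1
    have h2 : Filter.Tendsto (fun m => ‖eval (t m) l‖ ^ (minpoly A (π l)).natDegree)
        Filter.atTop (𝓝 0) := squeeze_zero (fun m => by positivity) htl h1
    have h3 := h2.rpow_const (p := ((minpoly A (π l)).natDegree : ℝ)⁻¹)
      (Or.inr (by positivity))
    simp only [Real.pow_rpow_inv_natCast (norm_nonneg _) hd0] at h3
    rwa [Real.zero_rpow (inv_ne_zero (Nat.cast_ne_zero.2 hd0))] at h3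
  have hbdd : ∃ B : ℝ, ∀ m, ‖t m‖ ≤ B := by
    have h1 : ∀ i, ∃ B : ℝ, ∀ m, ‖t m i‖ ≤ B := by
      intro i
      have h2 : Filter.Tendsto (fun m => 1 + ∑ j ∈ Finset.range (minpoly A (π (X i))).natDegree,
          ‖eval (c m) ((minpoly A (π (X i))).coeff j)‖) Filter.atTop
          (𝓝 (1 + ∑ j ∈ Finset.range (minpoly A (π (X i))).natDegree,
          ‖eval (proj p) ((minpoly A (π (X i))).coeff j)‖)) :=
        tendsto_const_nhds.add (tendsto_finsetSum _ fun j _ => (hcc _).norm)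
      obtain ⟨B, hB⟩ := h2.bddAbove_range
      refine ⟨B, fun m => le_trans ?_ (hB ⟨m, rfl⟩)⟩
      have h3 := hroot (t m) (htq m) (X i)
      rw [htc, eval_X] at h3
      have h4 := norm_root_le _ (hmonic _ _) _ h3
      rw [hdeg] at h4
      simpa only [Polynomial.coeff_map] using h4
    choose B hB using h1
    refine ⟨∑ i, |B i|, fun m => ?_⟩
    refine (pi_norm_le_iff_of_nonneg (Finset.sum_nonneg fun _ _ => abs_nonneg _)).2 fun i => ?_
    exact ((hB i m).trans (le_abs_self _)).trans
      (Finset.single_le_sum (f := fun i => |B i|) (fun _ _ => abs_nonneg _) (Finset.mem_univ i))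
  obtain ⟨B, hB⟩ := hbdd
  obtain ⟨u, -, φ, hφ, hu⟩ := tendsto_subseq_of_bounded (Metric.isBounded_closedBall (x := 0)
    (r := B)) (x := t) fun m => by simpa using hB m
  have hev : ∀ P, Filter.Tendsto (fun m => eval (t (φ m)) P) Filter.atTop (𝓝 (eval u P)) :=
    fun P => ((MvPolynomial.continuous_eval P).tendsto _).comp hu
  have huq : ∀ P ∈ q, eval u P = 0 := fun P hP =>
    tendsto_nhds_unique (hev P) (by simp only [htq _ P hP]; exact tendsto_const_nhds)
  have hup : proj u = proj p := by
    funext j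
    refine tendsto_nhds_unique (hev (Yp j)) ?_
    have : (fun m => eval (t (φ m)) (Yp j)) = fun m => c (φ m) j := by
      funext m
      exact congrFun (htc (φ m)) j
    rw [this]
    exact ((tendsto_pi_nhds.1 hc) j).comp hφ.tendsto_atTop
  have hul : eval u l = 0 := by
    have h1 := tendsto_nhds_unique (hev l).norm (hlim.comp hφ.tendsto_atTop)
    exact norm_eq_zero.1 h1
  have hue : u = p := by
    by_contra hne
    have hmem : u ∈ K := by
      refine Finset.mem_erase.2 ⟨hne, Fintype.mem_piFinset.2 fun i => ?_⟩
      rw [Multiset.mem_toFinset, Polynomial.mem_roots', ← hup]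
      refine ⟨(hmonic _ _).ne_zero, ?_⟩
      have h := hroot u huq (X i)
      rwa [eval_X] at h
    have h := heK u hmem
    simp [l, h] at hul
  rw [hue] at hu
  have hne : ∀ m, t (φ m) ≠ p := fun m h => hcne (φ m) (by rw [← htc, h])
  exact (tendsto_nhdsWithin_iff.2 ⟨hu, Filter.Eventually.of_forall hne⟩).frequently
    (Filter.Frequently.of_forall fun m => htq (φ m))

/-- The Nullstellensatz at an isolated zero: a function vanishing at an isolated zero `p` of an
ideal has a power in the ideal, after multiplication by a function not vanishing at `p`. -/
theorem exists_mul_pow_mem {k : ℕ} (J : Ideal (MvPolynomial (Fin k) ℂ)) (p : Fin k → ℂ)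
    (hiso : ∀ᶠ t in 𝓝[≠] p, ∃ P ∈ J, eval t P ≠ 0) (x : MvPolynomial (Fin k) ℂ)
    (hx : eval p x = 0) : ∃ h N, eval p h ≠ 0 ∧ h * x ^ N ∈ J := by
  let S : Submonoid (MvPolynomial (Fin k) ℂ) :=
    (Submonoid.comap (eval p) (nonZeroDivisors ℂ)) ⊔ Submonoid.powers x
  -- A prime containing `J` and avoiding `S` would define a variety through `p` and not just `p`.
  by_cases hdis : Disjoint (J : Set (MvPolynomial (Fin k) ℂ)) S
  · exfalso
    obtain ⟨q, hq, hJq, hqS⟩ := Ideal.exists_le_prime_disjoint J S hdis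
    have hqp : ∀ P ∈ q, eval p P = 0 := by
      intro P hP
      by_contra h
      exact Set.disjoint_left.1 hqS hP (Submonoid.mem_sup_left
        (Submonoid.mem_comap.2 (mem_nonZeroDivisors_of_ne_zero h)))
    have hxq : x ∉ q := fun h => Set.disjoint_left.1 hqS h
      (Submonoid.mem_sup_right (Submonoid.mem_powers x))
    obtain ⟨t, ht, P, hP, hne⟩ :=
      ((frequently_mem_zeroLocus q p hqp x hx hxq).and_eventually hiso).exists
    exact hne (ht P (hJq hP))
  · obtain ⟨y, hy, hyS⟩ := Set.not_disjoint_iff.1 hdis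
    obtain ⟨h, hh, w, ⟨N, rfl⟩, rfl⟩ := Submonoid.mem_sup.1 hyS
    exact ⟨h, N, nonZeroDivisors.ne_zero (Submonoid.mem_comap.1 hh), hy⟩

end IsolatedZero

/-! ### The Cauchy–Binet formula -/

open Classical in
/-- The Cauchy–Binet formula. -/
theorem Matrix.det_mul_eq_sum_strictMono {B : Type*} [CommRing B] {k n : ℕ}
    (P : Matrix (Fin k) (Fin n) B) (Q : Matrix (Fin n) (Fin k) B) :
    (P * Q).det = ∑ s : Fin k → Fin n with StrictMono s,
      (P.submatrix id s).det * (Q.submatrix s id).det := by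
  have h1 : (P * Q).det = ∑ s : Fin k → Fin n, (∏ i, P i (s i)) * (Q.submatrix s id).det := by
    have h2 : (P * Q).det = (Matrix.detRowAlternating (R := B) (n := Fin k)).toMultilinearMap
        (fun i => ∑ j, P i j • Q j) := by
      change Matrix.det _ = Matrix.det _
      congr 1
      ext i l
      simp [Matrix.mul_apply]
    rw [h2, MultilinearMap.map_sum]
    refine Finset.sum_congr rfl fun s _ => ?_
    rw [MultilinearMap.map_smul_univ]
    rfl
  have h3 : ∀ s : Fin k → Fin n, ¬ Function.Injective s → (Q.submatrix s id).det = 0 := by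
    intro s hs
    obtain ⟨i, j, hij, hne⟩ := Function.not_injective_iff.1 hs
    refine Matrix.det_zero_of_row_eq hne ?_
    funext l
    simp [hij]
  have h4 : ∀ s : Fin k → Fin n, (P.submatrix id s).det * (Q.submatrix s id).det =
      ∑ σ : Equiv.Perm (Fin k), (∏ i, P i (s (σ i))) * (Q.submatrix (s ∘ σ) id).det := by
    intro s
    rw [← Matrix.det_transpose, Matrix.det_apply', Finset.sum_mul]
    refine Finset.sum_congr rfl fun σ _ => ?_
    have h5 : (Q.submatrix (s ∘ σ) id).det = _ := Matrix.det_permute σ (Q.submatrix s id)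
    rw [h5]
    simp only [Matrix.transpose_apply, Matrix.submatrix_apply, id]
    ring
  rw [h1, ← Finset.sum_filter_add_sum_filter_not Finset.univ (fun s => Function.Injective s),
    Finset.sum_eq_zero (s := Finset.filter (fun s => ¬ Function.Injective s) _)
      (fun s hs => by rw [h3 s (Finset.mem_filter.1 hs).2, mul_zero]), add_zero]
  simp only [h4]
  rw [← Finset.sum_product']
  symm
  -- Every injective tuple is uniquely a rearrangement of an increasing one.
  refine Finset.sum_bij (fun x _ => x.1 ∘ x.2) ?_ ?_ ?_ ?_
  · rintro ⟨s, σ⟩ h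
    simp only [Finset.mem_product, Finset.mem_filter, Finset.mem_univ, true_and, and_true] at h
    simpa using h.injective
  · rintro ⟨s, σ⟩ h ⟨s', σ'⟩ h' heq
    simp only [Finset.mem_product, Finset.mem_filter, Finset.mem_univ, true_and, and_true] at h h'
    change s ∘ σ = s' ∘ σ' at heq
    have h5 := congrArg Set.range heq
    rw [EquivLike.range_comp, EquivLike.range_comp, h.range_inj h'] at h5
    subst h5
    refine Prod.ext rfl (Equiv.ext fun i => h.injective (congrFun heq i))
  · intro s hs
    have hs' : Function.Injective s := (Finset.mem_filter.1 hs).2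
    refine ⟨(s ∘ Tuple.sort s, (Tuple.sort s)⁻¹), ?_, ?_⟩
    · simp only [Finset.mem_product, Finset.mem_filter, Finset.mem_univ, true_and, and_true]
      exact (Tuple.monotone_sort s).strictMono_of_injective (hs'.comp (Equiv.injective _))
    · funext i
      simp
  · intro x _
    rfl

/-! ### Determinants of presentations of monomials -/

namespace MonomialPresentation

open MvPowerSeries

variable {A : Type*} [CommRing A] {k : ℕ}

/-- The exponent `(N, …, N)`. -/
def top (k N : ℕ) : Fin k →₀ ℕ := Finsupp.equivFunOnFinite.symm fun _ => N

/-- The ideal generated by `X_j^{N+1}`, `j ∈ s`. -/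
def powIdeal (A : Type*) [CommRing A] {k : ℕ} (N : ℕ) (s : Set (Fin k)) :
    Ideal (MvPowerSeries (Fin k) A) :=
  Ideal.span ((fun j => (X j : MvPowerSeries (Fin k) A) ^ (N + 1)) '' s)

theorem coeff_eq_zero_of_mem {N : ℕ} {s : Set (Fin k)} {z : MvPowerSeries (Fin k) A}
    (hz : z ∈ powIdeal A N s) (α : Fin k →₀ ℕ) (hα : ∀ j ∈ s, α j ≤ N) : coeff α z = 0 := by
  classical
  induction hz using Submodule.span_induction generalizing α with
  | mem x hx =>
    obtain ⟨j, hj, rfl⟩ := hx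
    exact X_pow_dvd_iff.1 dvd_rfl α (Nat.lt_succ_of_le (hα j hj))
  | zero => simp
  | add x y _ _ hx hy => rw [map_add, hx α hα, hy α hα, add_zero]
  | smul w x _ hx =>
    rw [smul_eq_mul, coeff_mul]
    refine Finset.sum_eq_zero fun β hβ => ?_
    have h := Finset.HasAntidiagonal.mem_antidiagonal.1 hβ
    have hle : β.2 ≤ α := h ▸ le_add_self
    rw [hx β.2 fun j hj => (hle j).trans (hα j hj), mul_zero]

theorem coeff_mul_X_sub_C (z : MvPowerSeries (Fin k) A) (i : Fin k) (t : A) (α : Fin k →₀ ℕ) :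
    coeff (α + Finsupp.single i 1) (z * (X i - C t)) =
      coeff α z - coeff (α + Finsupp.single i 1) z * t := by
  rw [mul_sub, map_sub, X_def, coeff_add_mul_monomial, mul_one, coeff_mul_C]

/-- If `t` is nilpotent then `X_i - t` is not a zero divisor modulo the powers of the other
variables, as far as coefficients are concerned. -/
theorem coeff_eq_zero_of_mul_mem_of_nilpotent {N : ℕ} {z : MvPowerSeries (Fin k) A} {i : Fin k}
    {t : A} (ht : IsNilpotent t) (hz : z * (X i - C t) ∈ powIdeal A N {j | j ≠ i})
    (α : Fin k →₀ ℕ) (hα : ∀ j, j ≠ i → α j ≤ N) : coeff α z = 0 := by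
  -- The hypothesis says `z_α = t z_{α + e_i}` on the relevant coefficients.
  have h1 : ∀ (m : ℕ) (α : Fin k →₀ ℕ), (∀ j, j ≠ i → α j ≤ N) →
      coeff α z = coeff (α + Finsupp.single i m) z * t ^ m := by
    intro m
    induction m with
    | zero => simp
    | succ m ih =>
      intro α hα
      have hα' : ∀ j, j ≠ i → (α + Finsupp.single i m) j ≤ N := by
        intro j hj
        simpa [hj.symm] using hα j hj
      have hα'' : ∀ j ∈ {j | j ≠ i},
          (α + Finsupp.single i m + Finsupp.single i 1 : Fin k →₀ ℕ) j ≤ N := by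
        intro j hj
        have hj' : i ≠ j := fun h => hj h.symm
        simpa [hj'] using hα j hj
      have h := coeff_eq_zero_of_mem hz _ hα''
      rw [coeff_mul_X_sub_C, sub_eq_zero] at h
      rw [ih α hα, h, add_assoc, ← Finsupp.single_add, pow_succ']
      ring
  obtain ⟨m, hm⟩ := ht
  rw [h1 m α hα, hm, mul_zero]

/-- If `t` is a unit then so is `X_i - t` modulo powers of the variables. -/
theorem coeff_eq_zero_of_mul_mem_of_isUnit {N : ℕ} {z : MvPowerSeries (Fin k) A} {i : Fin k}
    {t : A} (ht : IsUnit t) (hz : z * (X i - C t) ∈ powIdeal A N Set.univ)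
    (α : Fin k →₀ ℕ) (hα : ∀ j, α j ≤ N) : coeff α z = 0 := by
  classical
  obtain ⟨m, hm⟩ : ∃ m, m = α i := ⟨_, rfl⟩
  induction m generalizing α with
  | zero =>
    have h := coeff_eq_zero_of_mem hz α fun j _ => hα j
    have h0 : ¬ Finsupp.single i 1 ≤ α := fun h => by
      have := h i
      simp [← hm] at this
    rw [mul_sub, map_sub, X_def, coeff_mul_monomial, if_neg h0, coeff_mul_C, zero_sub,
      neg_eq_zero] at h
    exact (ht.mul_left_eq_zero).1 h
  | succ m ih =>
    obtain ⟨β, rfl⟩ : ∃ β, α = β + Finsupp.single i 1 := by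
      refine ⟨α - Finsupp.single i 1, (tsub_add_cancel_of_le ?_).symm⟩
      rw [Finsupp.single_le_iff]
      omega
    have h := coeff_eq_zero_of_mem hz _ fun j _ => hα j
    have hβ : ∀ j, β j ≤ N := fun j => le_trans (by simp) (hα j)
    rw [coeff_mul_X_sub_C, ih β hβ (by simpa using hm), zero_sub, neg_eq_zero] at h
    exact (ht.mul_left_eq_zero).1 h

/-- Cramer's rule. -/
theorem det_mul_mem {B : Type*} [CommRing B] (M : Matrix (Fin k) (Fin k) B) (v : Fin k → B)
    (I : Ideal B) (h : ∀ i, M.mulVec v i ∈ I) (l : Fin k) : M.det * v l ∈ I := by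
  have h1 : M.det • v = M.adjugate.mulVec (M.mulVec v) := by
    rw [Matrix.mulVec_mulVec, Matrix.adjugate_mul, Matrix.smul_mulVec, Matrix.one_mulVec]
  have h2 : M.det * v l = ∑ i, M.adjugate l i * M.mulVec v i := congrFun h1 l
  rw [h2]
  exact Ideal.sum_mem _ fun i _ => Ideal.mul_mem_left _ _ (h i)

/-- The coefficient at `∏ X_i^N` of the determinant of the diagonal solution. The exponent
`N + 1 - 1 - m` is in the form of the geometric sum for `X_i^{N+1} - t_i^{N+1}`. -/
theorem coeff_det_diagonal (N : ℕ) (t : Fin k → A) :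
    coeff (top k N) (∏ i, ∑ m ∈ Finset.range (N + 1),
      (X i : MvPowerSeries (Fin k) A) ^ m * C (t i) ^ (N + 1 - 1 - m)) = 1 := by
  classical
  rw [Finset.prod_univ_sum, map_sum, Finset.sum_eq_single (fun _ => N)]
  · simp only [Nat.add_sub_cancel, Nat.sub_self, pow_zero, mul_one, X_pow_eq]
    rw [prod_monomial, coeff_monomial, if_pos, Finset.prod_const_one]
    ext i
    simp [top, Finsupp.finsetSum_apply, Finsupp.single_apply]
  · intro x _ hx
    rw [Finset.prod_mul_distrib]
    simp only [X_pow_eq, ← map_pow]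
    rw [← map_prod, coeff_mul_C, prod_monomial, coeff_monomial, if_neg, zero_mul]
    intro h
    refine hx (funext fun i => ?_)
    have := DFunLike.congr_fun h i
    simpa [top, Finsupp.finsetSum_apply, Finsupp.single_apply] using this.symm
  · intro h
    exact absurd (Fintype.mem_piFinset.2 fun i => Finset.mem_range.2 (Nat.lt_succ_self N)) h

/-- The transformation law for the residue with respect to `X_1 - t_1, …, X_k - t_k`: if
`Q (X - t)` is the vector of the `X_i^{N+1}` then the coefficient of `det Q` at `∏ X_i^N` is `1`.
The rows of `Q` are exchanged one by one for those of the diagonal solution. -/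
theorem coeff_det_eq_one {N : ℕ} (t : Fin k → A) (ht : ∀ i, t i ^ (N + 1) = 0)
    (Q : Matrix (Fin k) (Fin k) (MvPowerSeries (Fin k) A))
    (hQ : ∀ i, Q.mulVec (fun l => X l - C (t l)) i = X i ^ (N + 1)) :
    coeff (top k N) Q.det = 1 := by
  classical
  let v : Fin k → MvPowerSeries (Fin k) A := fun l => X l - C (t l)
  let D : Matrix (Fin k) (Fin k) (MvPowerSeries (Fin k) A) := Matrix.diagonal fun i =>
    ∑ m ∈ Finset.range (N + 1), X i ^ m * C (t i) ^ (N + 1 - 1 - m)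
  have hD : ∀ i, D.mulVec v i = X i ^ (N + 1) := by
    intro i
    rw [Matrix.mulVec_diagonal, (Commute.all _ _).geom_sum₂_mul, ← map_pow, ht, map_zero, sub_zero]
  let R : Finset (Fin k) → Matrix (Fin k) (Fin k) (MvPowerSeries (Fin k) A) :=
    fun s i => if i ∈ s then D i else Q i
  have hR : ∀ s i, R s i ⬝ᵥ v = X i ^ (N + 1) := by
    intro s i
    by_cases h : i ∈ s
    · simp only [R, if_pos h]; exact hD i
    · simp only [R, if_neg h]; exact hQ i
  have key : ∀ s, coeff (top k N) (R s).det = coeff (top k N) Q.det := by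
    intro s
    induction s using Finset.induction_on with
    | empty => rfl
    | insert i s hi ih =>
      have h1 : R (insert i s) = (R s).updateRow i (R s i + (D i - Q i)) := by
        funext j
        rcases eq_or_ne j i with rfl | hji
        · rw [Matrix.updateRow_self]
          simp [R, hi]
        · rw [Matrix.updateRow_ne hji]
          simp [R, hji]
      let Z := (R s).updateRow i (D i - Q i)
      have h2 : (R (insert i s)).det = (R s).det + Z.det := by
        rw [h1, Matrix.det_updateRow_add, Matrix.updateRow_eq_self]
      have h3 : ∀ j, Z.mulVec v j ∈ powIdeal A N {j | j ≠ i} := by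
        intro j
        rcases eq_or_ne j i with rfl | hji
        · have : Z.mulVec v j = (D j - Q j) ⬝ᵥ v := by
            exact congrArg (· ⬝ᵥ v) Matrix.updateRow_self
          rw [this, sub_dotProduct]
          have h4 : D j ⬝ᵥ v = _ := hD j
          have h5 : Q j ⬝ᵥ v = _ := hQ j
          rw [h4, h5, sub_self]
          exact Ideal.zero_mem _
        · have : Z.mulVec v j = R s j ⬝ᵥ v := by
            exact congrArg (· ⬝ᵥ v) (Matrix.updateRow_ne hji)
          rw [this, hR]
          exact Ideal.subset_span ⟨j, hji, rfl⟩
      rw [h2, map_add, ih, coeff_eq_zero_of_mul_mem_of_nilpotent ⟨N + 1, ht i⟩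
        (det_mul_mem Z v _ h3 i) (top k N) (fun j _ => le_rfl), add_zero]
  have h6 : R Finset.univ = D := by
    funext i
    simp [R]
  rw [← key Finset.univ, h6, Matrix.det_diagonal]
  exact coeff_det_diagonal N t

end MonomialPresentation

/-! ### Existence of residue presentations -/

namespace HolGerm

variable {k : ℕ} {p : Fin k → ℂ}

theorem isUnit_of_eval_ne_zero {φ : HolGerm p} (h : eval p φ ≠ 0) : IsUnit φ := by
  obtain ⟨f, hf, rfl⟩ := mk_surj φ
  have h0 : f p ≠ 0 := h
  refine IsUnit.of_mul_eq_one (mk _ (hf.fun_inv h0)) ?_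
  rw [mk_mul, ← map_one (algebraMap ℂ (HolGerm p)), ← mk_const, mk_eq_mk]
  filter_upwards [hf.continuousAt.eventually_ne h0] with t ht
  exact mul_inv_cancel₀ ht

theorem mk_prod {ι : Type*} (s : Finset ι) (f : ι → (Fin k → ℂ) → ℂ)
    (hf : ∀ i, AnalyticAt ℂ (f i) p) :
    ∏ i ∈ s, mk (f i) (hf i) =
      mk (fun t => ∏ i ∈ s, f i t) (Finset.analyticAt_fun_prod s fun i _ => hf i) := by
  classical
  induction s using Finset.induction_on with
  | empty =>
    rw [Finset.prod_empty, ← map_one (algebraMap ℂ (HolGerm p)), ← mk_const, mk_eq_mk]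
    simp
  | insert i s hi ih =>
    rw [Finset.prod_insert hi, ih, mk_mul, mk_eq_mk]
    exact Filter.Eventually.of_forall fun t => by simp [Finset.prod_insert hi]

/-- The germ of a polynomial function. -/
theorem exists_aeval_eq_mk (P : MvPolynomial (Fin k) ℂ) :
    ∃ hf, MvPolynomial.aeval (fun i => coord p i + algebraMap ℂ (HolGerm p) (p i)) P =
      mk (fun t => MvPolynomial.eval t P) hf := by
  induction P using MvPolynomial.induction_on with
  | C c =>
    refine ⟨by simpa using analyticAt_const, ?_⟩
    rw [MvPolynomial.algHom_C, ← mk_const, mk_eq_mk]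
    simp
  | add P Q hP hQ =>
    obtain ⟨hf, h1⟩ := hP
    obtain ⟨hg, h2⟩ := hQ
    refine ⟨by simpa [Pi.add_def] using hf.add hg, ?_⟩
    rw [map_add, h1, h2]
    refine (mk_eq_mk (hf := hf.add hg)).2 (Filter.Eventually.of_forall fun t => ?_)
    simp
  | mul_X P i hP =>
    obtain ⟨hf, h1⟩ := hP
    refine ⟨by simpa [Pi.mul_def] using hf.mul (analyticAt_apply p i), ?_⟩
    rw [map_mul, h1, MvPolynomial.aeval_X, coord, ← mk_const]
    refine (mk_eq_mk (hf := hf.mul (((analyticAt_apply p i).fun_sub analyticAt_const).add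
      analyticAt_const))).2 (Filter.Eventually.of_forall fun t => ?_)
    simp

/-- If an ideal contains powers of all coordinates, the residue is defined by a presentation. -/
theorem nonempty_residueFrame {F : Fin k → HolGerm p}
    (h : ∀ i, ∃ N : ℕ, coord p i ^ N ∈ Ideal.span (Set.range F)) : Nonempty (ResidueFrame F) := by
  choose N hN using h
  have h1 : ∀ i, coord p i ^ (∑ j, N j + 1) ∈ Ideal.span (Set.range F) := by
    intro i
    refine Ideal.mem_of_dvd _ (pow_dvd_pow _ ?_) (hN i)
    exact (Finset.single_le_sum (f := N) (fun _ _ => Nat.zero_le _) (Finset.mem_univ i)).trans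
      (Nat.le_succ _)
  choose c hc using fun i => (Ideal.mem_span_range_iff_exists_fun (R := HolGerm p)).1 (h1 i)
  exact ⟨⟨∑ j, N j, c, fun i => (hc i).symm⟩⟩

/-! ### Duality for the residue -/

/-- The Taylor expansion of a germ, with coefficients viewed in a `ℂ`-algebra `A`. -/
def taylorOver (A : Type*) [CommRing A] [Algebra ℂ A] (p : Fin k → ℂ) :
    HolGerm p →+* MvPowerSeries (Fin k) A :=
  (MvPowerSeries.map (algebraMap ℂ A)).comp (taylor p : HolGerm p →+* MvPowerSeries (Fin k) ℂ)

section

variable {A : Type*} [CommRing A] [Algebra ℂ A]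

theorem coeff_taylorOver (α : Fin k →₀ ℕ) (φ : HolGerm p) :
    MvPowerSeries.coeff α (taylorOver A p φ) = algebraMap ℂ A (coeff p α φ) := rfl

theorem taylorOver_coord (i : Fin k) : taylorOver A p (coord p i) = MvPowerSeries.X i := by
  change MvPowerSeries.map _ (taylor p (coord p i)) = _
  rw [taylor_coord, MvPowerSeries.map_X]

theorem taylorOver_algebraMap (c : ℂ) :
    taylorOver A p (algebraMap ℂ _ c) = MvPowerSeries.C (algebraMap ℂ A c) := by
  change MvPowerSeries.map _ (taylor p (algebraMap ℂ _ c)) = _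
  rw [AlgHom.commutes]
  exact MvPowerSeries.map_C _ _

open MonomialPresentation in
theorem taylorOver_mem_powIdeal {N : ℕ} {φ : HolGerm p}
    (hφ : φ ∈ Ideal.span (Set.range fun i => coord p i ^ (N + 1))) :
    taylorOver A p φ ∈ powIdeal A (k := k) N Set.univ := by
  have : Ideal.span (Set.range fun i => coord p i ^ (N + 1)) ≤
      (powIdeal A (k := k) N Set.univ).comap (taylorOver A p) := by
    rw [Ideal.span_le]
    rintro _ ⟨i, rfl⟩
    change taylorOver A p (coord p i ^ (N + 1)) ∈ powIdeal A (k := k) N Set.univ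
    rw [map_pow, taylorOver_coord]
    exact Ideal.subset_span ⟨i, trivial, rfl⟩
  exact this hφ

theorem ResidueFrame.mulVec_presentation {F : Fin k → HolGerm p} (D : ResidueFrame F)
    (τ : Fin k → A)
    (M : Matrix (Fin k) (Fin k) (MvPowerSeries (Fin k) A))
    (hM : ∀ i, M.mulVec (fun l => MvPowerSeries.X l - MvPowerSeries.C (τ l)) i =
      taylorOver A p (F i)) (i : Fin k) :
    (((taylorOver A p).mapMatrix D.c) * M).mulVec
      (fun l => MvPowerSeries.X l - MvPowerSeries.C (τ l)) i = MvPowerSeries.X i ^ (D.N + 1) := by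
  rw [← Matrix.mulVec_mulVec, funext hM, ← taylorOver_coord, ← map_pow, D.pow_eq, map_sum]
  simp [Matrix.mulVec, dotProduct]

open MonomialPresentation in
/-- The Bezoutian pairs to zero if one of the differences of coordinates is invertible. -/
theorem ResidueFrame.coeff_det_mul_eq_zero {F : Fin k → HolGerm p} (D : ResidueFrame F)
    (τ : Fin k → A)
    (M : Matrix (Fin k) (Fin k) (MvPowerSeries (Fin k) A))
    (hM : ∀ i, M.mulVec (fun l => MvPowerSeries.X l - MvPowerSeries.C (τ l)) i =
      taylorOver A p (F i)) (l : Fin k) (hl : IsUnit (τ l)) (h : HolGerm p) :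
    MvPowerSeries.coeff (top k D.N) (M.det * taylorOver A p (D.c.det * h)) = 0 := by
  have h1 := det_mul_mem _ _ (powIdeal A D.N Set.univ) (fun i => by
    rw [D.mulVec_presentation τ M hM i]
    exact Ideal.subset_span ⟨i, trivial, rfl⟩) l
  refine coeff_eq_zero_of_mul_mem_of_isUnit (N := D.N) (i := l) hl ?_ _ (fun j => le_rfl)
  rw [Matrix.det_mul, ← RingHom.map_det] at h1
  rw [map_mul, show M.det * (taylorOver A p D.c.det * taylorOver A p h) *
    (MvPowerSeries.X l - MvPowerSeries.C (τ l)) = taylorOver A p h *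
      (taylorOver A p D.c.det * M.det * (MvPowerSeries.X l - MvPowerSeries.C (τ l))) by ring]
  exact Ideal.mul_mem_left _ _ h1

open MonomialPresentation in
/-- The Bezoutian is the kernel of the identity: pairing it with `h` in one group of variables
gives back the class of `h` in the other. -/
theorem ResidueFrame.coeff_det_mul_eq {F : Fin k → HolGerm p} (D : ResidueFrame F)
    (M : Matrix (Fin k) (Fin k)
      (MvPowerSeries (Fin k) (HolGerm p ⧸ Ideal.span (Set.range F))))
    (hM : ∀ i, M.mulVec (fun l => MvPowerSeries.X l -
      MvPowerSeries.C (Ideal.Quotient.mk _ (coord p l))) i = taylorOver _ p (F i))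
    (h : HolGerm p) :
    MvPowerSeries.coeff (top k D.N) (M.det * taylorOver _ p (D.c.det * h)) =
      Ideal.Quotient.mk _ h := by
  let A := HolGerm p ⧸ Ideal.span (Set.range F)
  let τ : Fin k → A := fun l => Ideal.Quotient.mk _ (coord p l)
  have hQ := D.mulVec_presentation τ M hM
  set Q := ((taylorOver A p).mapMatrix D.c) * M with hQdef
  have hdet : Q.det = taylorOver A p D.c.det * M.det := by
    rw [hQdef, Matrix.det_mul, ← RingHom.map_det]
  have hG : ∀ φ ∈ Ideal.span (Set.range fun i => coord p i ^ (D.N + 1)),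
      φ ∈ Ideal.span (Set.range F) := by
    intro φ hφ
    refine Ideal.span_le.2 ?_ hφ
    rintro _ ⟨i, rfl⟩
    exact D.coord_pow_mem i
  have hτ : ∀ i, τ i ^ (D.N + 1) = 0 := by
    intro i
    rw [← map_pow]
    exact Ideal.Quotient.eq_zero_iff_mem.2 (D.coord_pow_mem i)
  have h1 : ∀ l, Q.det * (MvPowerSeries.X l - MvPowerSeries.C (τ l)) ∈
      powIdeal A D.N Set.univ := fun l =>
    det_mul_mem Q (fun l => MvPowerSeries.X l - MvPowerSeries.C (τ l)) _ (fun i => by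
      rw [hQ]
      exact Ideal.subset_span ⟨i, trivial, rfl⟩) l
  -- Multiplying by `h(u)` or by `h(t)` is the same: clear for the coordinates by Cramer's rule,
  -- hence for polynomials, and every germ is a polynomial modulo the powers of the coordinates.
  have key : Q.det * (taylorOver A p h - MvPowerSeries.C (Ideal.Quotient.mk _ h)) ∈
      powIdeal A D.N Set.univ := by
    obtain ⟨m, hm⟩ := D.exists_pow_le
    obtain ⟨q, hq⟩ := exists_sub_aeval_mem_pow m h
    have h2 : ∀ q : MvPolynomial (Fin k) ℂ,
        Q.det * (taylorOver A p (MvPolynomial.aeval (coord p) q) -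
          MvPowerSeries.C (Ideal.Quotient.mk _ (MvPolynomial.aeval (coord p) q))) ∈
        powIdeal A D.N Set.univ := by
      intro q
      induction q using MvPolynomial.induction_on with
      | C c =>
        rw [MvPolynomial.algHom_C, taylorOver_algebraMap]
        have : (algebraMap ℂ A c) = Ideal.Quotient.mk _ (algebraMap ℂ (HolGerm p) c) := rfl
        rw [this, sub_self, mul_zero]
        exact Ideal.zero_mem _
      | add q r hq hr =>
        simp only [map_add]
        convert! Ideal.add_mem _ hq hr using 1
        ring
      | mul_X q i hq =>
        simp only [map_mul, MvPolynomial.aeval_X, taylorOver_coord]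
        convert! Ideal.add_mem _ (Ideal.mul_mem_right (MvPowerSeries.X i) _ hq)
          (Ideal.mul_mem_left _ (MvPowerSeries.C (Ideal.Quotient.mk _
            (MvPolynomial.aeval (coord p) q))) (h1 i)) using 1
        ring
    have h3 := taylorOver_mem_powIdeal (A := A) (hm hq)
    have h4 : (Ideal.Quotient.mk (Ideal.span (Set.range F)) h) =
        Ideal.Quotient.mk _ (MvPolynomial.aeval (coord p) q) :=
      Ideal.Quotient.eq.2 (hG _ (hm hq))
    rw [h4]
    convert! Ideal.add_mem _ (h2 q) (Ideal.mul_mem_left _ Q.det h3) using 1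
    rw [map_sub]
    ring
  have h5 := coeff_eq_zero_of_mem key (top k D.N) (fun j _ => le_rfl)
  rw [mul_sub, map_sub, MvPowerSeries.coeff_mul_C, coeff_det_eq_one τ hτ Q hQ, one_mul,
    sub_eq_zero] at h5
  rw [← h5, hdet, map_mul (taylorOver A p)]
  congr 1
  ring

end

end HolGerm

namespace Arrangement

open HolGerm

variable {n k : ℕ} {a : Fin n → ℂ} {b : Fin n → Fin k → ℂ} {z : Fin n → ℂ} {p q : Fin k → ℂ}

/-! ### Isolated critical points -/

/-- The polynomial `∏_l f_l · ∂Φ/∂t_i`. -/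
def gradPoly (a : Fin n → ℂ) (b : Fin n → Fin k → ℂ) (z : Fin n → ℂ) (i : Fin k) :
    MvPolynomial (Fin k) ℂ :=
  ∑ j, MvPolynomial.C (a j * b j i) * ∏ l ∈ Finset.univ.erase j,
    (MvPolynomial.C (z l) + ∑ m, MvPolynomial.C (b l m) * MvPolynomial.X m)

theorem eval_gradPoly (i : Fin k) {t : Fin k → ℂ} (ht : t ∈ complement b z) :
    MvPolynomial.eval t (gradPoly a b z i) =
      (∏ l, affineForm b z l t) * partialPhi a b z i t := by
  have h : ∀ l, MvPolynomial.eval t (MvPolynomial.C (z l) + ∑ m, MvPolynomial.C (b l m) *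
      MvPolynomial.X m) = affineForm b z l t := fun l => by simp [affineForm]
  rw [gradPoly, map_sum, partialPhi, Finset.mul_sum]
  refine Finset.sum_congr rfl fun j _ => ?_
  rw [map_mul, map_prod, MvPolynomial.eval_C]
  simp only [h]
  rw [← Finset.mul_prod_erase Finset.univ _ (Finset.mem_univ j)]
  have := affineForm_ne_zero ht j
  field_simp

theorem nonempty_residueFrame_gradGerm (hp : p ∈ isolatedCriticalSet a b z) :
    Nonempty (ResidueFrame (gradGerm a b z hp.1.1)) := by
  refine nonempty_residueFrame fun i => ?_
  let J : Ideal (MvPolynomial (Fin k) ℂ) := Ideal.span (Set.range (gradPoly a b z))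
  have hprod : ∀ {t}, t ∈ complement b z → (∏ l, affineForm b z l t) ≠ 0 := fun ht =>
    Finset.prod_ne_zero_iff.2 fun l _ => affineForm_ne_zero ht l
  have hiso : ∀ᶠ t in 𝓝[≠] p, ∃ P ∈ J, MvPolynomial.eval t P ≠ 0 := by
    filter_upwards [hp.2, (eventually_mem_complement hp.1.1).filter_mono nhdsWithin_le_nhds]
      with t h1 h2
    by_contra hcon
    push Not at hcon
    refine h1 ⟨h2, fun i => ?_⟩
    have h3 := hcon _ (Ideal.subset_span ⟨i, rfl⟩)
    rw [eval_gradPoly i h2] at h3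
    exact (mul_eq_zero.1 h3).resolve_left (hprod h2)
  obtain ⟨h, N, hh, hN⟩ := IsolatedZero.exists_mul_pow_mem J p hiso
    (MvPolynomial.X i - MvPolynomial.C (p i)) (by simp)
  refine ⟨N, ?_⟩
  let φ : MvPolynomial (Fin k) ℂ →ₐ[ℂ] HolGerm p :=
    MvPolynomial.aeval (fun i => coord p i + algebraMap ℂ (HolGerm p) (p i))
  have hJ : J ≤ (Ideal.span (Set.range (gradGerm a b z hp.1.1))).comap φ := by
    rw [Ideal.span_le]
    rintro _ ⟨i, rfl⟩
    obtain ⟨hf, h1⟩ := exists_aeval_eq_mk (p := p) (gradPoly a b z i)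
    change φ _ ∈ Ideal.span _
    have h2 : φ (gradPoly a b z i) =
        mk (fun t => ∏ l, affineForm b z l t)
          (Finset.analyticAt_fun_prod _ fun l _ => analyticAt_affineForm b z l p) *
        gradGerm a b z hp.1.1 i := by
      refine h1.trans ?_
      rw [gradGerm, mk_mul, mk_eq_mk]
      filter_upwards [eventually_mem_complement hp.1.1] with t ht
      exact eval_gradPoly i ht
    rw [h2]
    exact Ideal.mul_mem_left _ _ (Ideal.subset_span ⟨i, rfl⟩)
  have h1 := hJ hN
  rw [Ideal.mem_comap, map_mul, map_pow] at h1
  have h2 : φ (MvPolynomial.X i - MvPolynomial.C (p i)) = coord p i := by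
    rw [map_sub, MvPolynomial.aeval_X, MvPolynomial.algHom_C, add_sub_cancel_right]
  have h3 : IsUnit (φ h) := by
    obtain ⟨hf, h4⟩ := exists_aeval_eq_mk (p := p) h
    refine isUnit_of_eval_ne_zero ?_
    rw [show φ h = _ from h4, eval_mk]
    exact hh
  rw [h2] at h1
  exact (Ideal.unit_mul_mem_iff_mem _ h3).1 h1

theorem nontrivial_localAlgebra (hp : p ∈ criticalSet a b z) :
    Nontrivial (LocalAlgebra a b z hp.1) := by
  refine Ideal.Quotient.nontrivial_iff.2 fun h => ?_
  have h1 : Ideal.span (Set.range (gradGerm a b z hp.1)) ≤ RingHom.ker (eval p) := by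
    rw [Ideal.span_le]
    rintro _ ⟨i, rfl⟩
    exact hp.2 i
  have h2 := h1 (h ▸ Submodule.mem_top : (1 : HolGerm p) ∈ _)
  rw [RingHom.mem_ker, map_one] at h2
  exact one_ne_zero h2

/-! ### The Bezoutian of the gradient of the master function -/

/-- The germ at `p ∈ U` of `1 / f_j`. -/
def invGerm (b : Fin n → Fin k → ℂ) (z : Fin n → ℂ) (hp : p ∈ complement b z) (j : Fin n) :
    HolGerm p :=
  mk (fun t => (affineForm b z j t)⁻¹)
    ((analyticAt_affineForm b z j p).fun_inv (affineForm_ne_zero hp j))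

/-- The germ at `p ∈ U` of the coefficient of a logarithmic form. -/
def symGerm (b : Fin n → Fin k → ℂ) (z : Fin n → ℂ) (hp : p ∈ complement b z)
    (s : Fin k → Fin n) : HolGerm p :=
  mk (symFun b z s) (analyticAt_symFun b z hp s)

theorem symGerm_eq (hp : p ∈ complement b z) (s : Fin k → Fin n) :
    symGerm b z hp s = algebraMap ℂ _ (Matrix.of fun l i => b (s l) i).det *
      ∏ l, invGerm b z hp (s l) := by
  simp only [invGerm]
  rw [mk_prod Finset.univ (fun l t => (affineForm b z (s l) t)⁻¹), ← mk_const, mk_mul]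
  rfl

theorem gradGerm_eq (hp : p ∈ complement b z) (i : Fin k) :
    gradGerm a b z hp i = ∑ j, algebraMap ℂ _ (a j * b j i) * invGerm b z hp j := by
  simp only [invGerm, ← mk_const, mk_mul]
  rw [mk_sum, gradGerm, mk_eq_mk]
  exact Filter.Eventually.of_forall fun t => Finset.sum_congr rfl fun j _ => div_eq_mul_inv _ _

theorem invGerm_mul (hp : p ∈ complement b z) (q : Fin k → ℂ) (j : Fin n) :
    invGerm b z hp j * (algebraMap ℂ _ (affineForm b z j q) +
      ∑ l, algebraMap ℂ _ (b j l) * (coord p l + algebraMap ℂ _ (p l - q l))) = 1 := by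
  simp only [invGerm, ← mk_const, coord]
  have h : ∀ l, mk (fun _ => b j l) analyticAt_const * (mk (fun t => t l - p l)
      ((analyticAt_apply p l).fun_sub analyticAt_const) +
        mk (fun _ => p l - q l) analyticAt_const) =
      mk (p := p) (fun t => b j l * (t l - q l))
        (analyticAt_const.mul ((analyticAt_apply p l).fun_sub analyticAt_const)) := by
    intro l
    refine (mk_eq_mk (hf := analyticAt_const.mul (((analyticAt_apply p l).fun_sub
      analyticAt_const).add analyticAt_const))).2 (Filter.Eventually.of_forall fun t => ?_)
    change b j l * (t l - p l + (p l - q l)) = _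
    ring
  simp only [h]
  rw [mk_sum Finset.univ (fun l t => b j l * (t l - q l)), ← map_one (algebraMap ℂ (HolGerm p)),
    ← mk_const]
  refine (mk_eq_mk (hf := ((analyticAt_affineForm b z j p).fun_inv (affineForm_ne_zero hp j)).mul
    (analyticAt_const.add (Finset.analyticAt_fun_sum _ fun l _ => analyticAt_const.mul
      ((analyticAt_apply p l).fun_sub analyticAt_const))))).2 ?_
  filter_upwards [eventually_mem_complement hp] with t ht
  have h0 := affineForm_ne_zero ht j
  have h1 : affineForm b z j q + ∑ l, b j l * (t l - q l) = affineForm b z j t := by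
    simp only [affineForm, mul_sub, Finset.sum_sub_distrib]
    ring
  change (affineForm b z j t)⁻¹ * (affineForm b z j q + ∑ l, b j l * (t l - q l)) = 1
  rw [h1, inv_mul_cancel₀ h0]

/-- The class in the local algebra at `p` of the function `t ↦ t_l - q_l`. -/
def shift (a : Fin n → ℂ) (hp : p ∈ complement b z) (q : Fin k → ℂ) (l : Fin k) :
    LocalAlgebra a b z hp :=
  Ideal.Quotient.mk _ (coord p l) + algebraMap ℂ _ (p l - q l)

/-- The matrix `-∑_j a_j b_j^i b_j^l / (f_j(t) f_j(u))`, with `t` taken in the local algebra at `p`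
and `u` expanded at `q`. It takes the vector `u - t` to the gradient at `u` minus the gradient
at `t`. -/
def bezoutMatrix (a : Fin n → ℂ) (b : Fin n → Fin k → ℂ) (z : Fin n → ℂ)
    (hp : p ∈ complement b z) (hq : q ∈ complement b z) :
    Matrix (Fin k) (Fin k) (MvPowerSeries (Fin k) (LocalAlgebra a b z hp)) :=
  -((Matrix.of fun i j => MvPowerSeries.C (algebraMap ℂ _ (a j * b j i) *
      Ideal.Quotient.mk _ (invGerm b z hp j)) :
      Matrix (Fin k) (Fin n) (MvPowerSeries (Fin k) (LocalAlgebra a b z hp))) *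
    (Matrix.of fun j l => MvPowerSeries.C (algebraMap ℂ _ (b j l)) *
      taylorOver (LocalAlgebra a b z hp) q (invGerm b z hq j) :
      Matrix (Fin n) (Fin k) (MvPowerSeries (Fin k) (LocalAlgebra a b z hp))))

theorem bezoutMatrix_mulVec (hp : p ∈ complement b z) (hq : q ∈ complement b z) (i : Fin k) :
    (bezoutMatrix a b z hp hq).mulVec
        (fun l => MvPowerSeries.X l - MvPowerSeries.C (shift a hp q l)) i =
      taylorOver (LocalAlgebra a b z hp) q (gradGerm a b z hq i) := by
  set x : Fin n → LocalAlgebra a b z hp := fun j => Ideal.Quotient.mk _ (invGerm b z hp j) with hx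
  set y : Fin n → MvPowerSeries (Fin k) (LocalAlgebra a b z hp) := fun j =>
    taylorOver (LocalAlgebra a b z hp) q (invGerm b z hq j) with hy
  set c : ℂ →+* MvPowerSeries (Fin k) (LocalAlgebra a b z hp) :=
    MvPowerSeries.C.comp (algebraMap ℂ _) with hc
  have hx1 : ∀ j, MvPowerSeries.C (x j) * (c (affineForm b z j q) + ∑ l, c (b j l) *
      MvPowerSeries.C (shift a hp q l)) = 1 := by
    intro j
    have h := congrArg (Ideal.Quotient.mk (Ideal.span (Set.range (gradGerm a b z hp))))
      (invGerm_mul hp q j)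
    have h' := congrArg (MvPowerSeries.C (σ := Fin k)) h
    simp only [map_mul, map_add, map_sum, map_one] at h'
    simp only [shift, map_add]
    exact h'
  have hy1 : ∀ j, y j * (c (affineForm b z j q) + ∑ l, c (b j l) * MvPowerSeries.X l) = 1 := by
    intro j
    have h := congrArg (taylorOver (LocalAlgebra a b z hp) q) (invGerm_mul hq q j)
    simp only [map_mul, map_add, map_sum, map_one, taylorOver_coord, taylorOver_algebraMap,
      sub_self, map_zero, add_zero] at h
    exact h
  have hF : ∑ j, c (a j * b j i) * MvPowerSeries.C (x j) = 0 := by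
    have h0 : Ideal.Quotient.mk (Ideal.span (Set.range (gradGerm a b z hp)))
        (gradGerm a b z hp i) = 0 :=
      Ideal.Quotient.eq_zero_iff_mem.2 (Ideal.subset_span ⟨i, rfl⟩)
    rw [gradGerm_eq] at h0
    have h' := congrArg (MvPowerSeries.C (σ := Fin k)) h0
    simp only [map_mul, map_sum, map_zero] at h'
    simp only [map_mul]
    exact h'
  have hd : ∀ j, y j - MvPowerSeries.C (x j) = -(MvPowerSeries.C (x j) * y j *
      ∑ l, c (b j l) * (MvPowerSeries.X l - MvPowerSeries.C (shift a hp q l))) := by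
    intro j
    simp only [mul_sub, Finset.sum_sub_distrib]
    linear_combination MvPowerSeries.C (x j) * hy1 j - (y j) * hx1 j
  have hR : taylorOver (LocalAlgebra a b z hp) q (gradGerm a b z hq i) =
      ∑ j, c (a j * b j i) * (y j - MvPowerSeries.C (x j)) := by
    simp only [mul_sub, Finset.sum_sub_distrib, hF, sub_zero]
    rw [gradGerm_eq, map_sum]
    refine Finset.sum_congr rfl fun j _ => ?_
    rw [map_mul, taylorOver_algebraMap]
    rfl
  rw [hR, bezoutMatrix, Matrix.neg_mulVec, ← Matrix.mulVec_mulVec]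
  simp only [Pi.neg_apply, Matrix.mulVec, dotProduct, Matrix.of_apply]
  rw [← Finset.sum_neg_distrib]
  refine Finset.sum_congr rfl fun j _ => ?_
  rw [hd, Finset.mul_sum, Finset.mul_sum, mul_neg, Finset.mul_sum, neg_inj]
  refine Finset.sum_congr rfl fun l _ => ?_
  rw [map_mul MvPowerSeries.C]
  change c _ * _ * (c _ * y j * _) = _
  ring

open Classical in
/-- The determinant of the Bezout matrix is, up to the sign `(-1)^k`, the value of the contravariant
form on two copies of the canonical element. -/
theorem det_bezoutMatrix (hp : p ∈ complement b z) (hq : q ∈ complement b z) :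
    (bezoutMatrix a b z hp hq).det = (-1) ^ k * ∑ s : Fin k → Fin n with StrictMono s,
      MvPowerSeries.C (algebraMap ℂ _ (∏ i, a (s i)) * Ideal.Quotient.mk _ (symGerm b z hp s)) *
        taylorOver (LocalAlgebra a b z hp) q (symGerm b z hq s) := by
  rw [bezoutMatrix, Matrix.det_neg, Matrix.det_mul_eq_sum_strictMono, Fintype.card_fin]
  congr 1
  refine Finset.sum_congr rfl fun s _ => ?_
  set c : ℂ →+* MvPowerSeries (Fin k) (LocalAlgebra a b z hp) :=
    MvPowerSeries.C.comp (algebraMap ℂ _) with hc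
  let M : Matrix (Fin k) (Fin k) ℂ := Matrix.of fun l i => b (s l) i
  congr 1
  · have h1 : (Matrix.of fun i j => (MvPowerSeries.C (σ := Fin k) (algebraMap ℂ
        (LocalAlgebra a b z hp) (a j * b j i) * Ideal.Quotient.mk _
          (invGerm b z hp j)))).submatrix id s =
        Matrix.of fun i l => (c (a (s l)) * MvPowerSeries.C (Ideal.Quotient.mk _
          (invGerm b z hp (s l)))) * (c.mapMatrix M.transpose) i l := by
      ext1 i l
      simp only [Matrix.submatrix_apply, Matrix.of_apply, map_mul, RingHom.mapMatrix_apply,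
        Matrix.map_apply, Matrix.transpose_apply, M, hc, RingHom.comp_apply, id]
      ring
    rw [h1, Matrix.det_mul_row, ← RingHom.map_det, Matrix.det_transpose, symGerm_eq,
      Finset.prod_mul_distrib, map_mul (Ideal.Quotient.mk _), map_prod (Ideal.Quotient.mk _),
      map_mul MvPowerSeries.C, map_mul MvPowerSeries.C, map_prod MvPowerSeries.C,
      map_prod (algebraMap ℂ _), map_prod MvPowerSeries.C]
    change (∏ i, c _) * _ * c _ = (∏ i, c _) * (c _ * _)
    ring
  · have h1 : (Matrix.of fun j l => (MvPowerSeries.C (σ := Fin k) (algebraMap ℂ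
        (LocalAlgebra a b z hp) (b j l))) * taylorOver (LocalAlgebra a b z hp) q
          (invGerm b z hq j)).submatrix s id =
        Matrix.of fun i l => taylorOver (LocalAlgebra a b z hp) q (invGerm b z hq (s i)) *
          (c.mapMatrix M) i l := by
      ext1 i l
      simp only [Matrix.submatrix_apply, Matrix.of_apply, RingHom.mapMatrix_apply,
        Matrix.map_apply, M, hc, RingHom.comp_apply, id]
      ring
    rw [h1, Matrix.det_mul_column, ← RingHom.map_det, symGerm_eq, map_mul, map_prod,
      taylorOver_algebraMap, mul_comm]
    rfl

end Arrangement

/-! ### Nondegenerate orthogonal families -/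

/-- Orthogonal images of nondegenerate forms contribute their dimensions to the rank. -/
theorem sum_finrank_le_bilinRank {ι V : Type*} [AddCommGroup V] [Module ℂ V]
    [FiniteDimensional ℂ V] {A : ι → Type*} [∀ i, AddCommGroup (A i)] [∀ i, Module ℂ (A i)]
    [∀ i, Module.Finite ℂ (A i)] (B : LinearMap.BilinForm ℂ V) (S : Submodule ℂ V)
    (α : ∀ i, A i →ₗ[ℂ] V) (hS : ∀ i x, α i x ∈ S)
    (horth : ∀ i j, i ≠ j → ∀ x y, B (α i x) (α j y) = 0)
    (hnd : ∀ i x, (∀ y, B (α i x) (α i y) = 0) → x = 0) (t : Finset ι) :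
    ∑ i ∈ t, Module.finrank ℂ (A i) ≤ bilinRank (B.restrict S) := by
  classical
  let ψ : (∀ i : t, A i) →ₗ[ℂ] S :=
    ∑ i : t, ((α i).codRestrict S (hS i)) ∘ₗ LinearMap.proj i
  have hψ : ∀ x, (ψ x : V) = ∑ i : t, α i (x i) := by
    intro x
    simp [ψ, LinearMap.sum_apply]
  have hinj : Function.Injective ((B.restrict S).rangeRestrict ∘ₗ ψ) := by
    rw [injective_iff_map_eq_zero]
    intro x hx
    have hx' : B.restrict S (ψ x) = 0 := congrArg Subtype.val hx
    funext i
    refine hnd i (x i) fun y => ?_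
    have h1 : B (ψ x : V) (α i y) = 0 := LinearMap.congr_fun hx' ⟨α i y, hS i y⟩
    rw [hψ, map_sum, LinearMap.sum_apply, Finset.sum_eq_single i] at h1
    · exact h1
    · intro j _ hj
      exact horth j i (fun h => hj (Subtype.ext h)) _ _
    · intro h
      exact absurd (Finset.mem_univ i) h
  have h := LinearMap.finrank_le_finrank_of_injective hinj
  rw [Module.finrank_pi_fintype] at h
  rw [← Finset.sum_coe_sort]
  exact h

theorem iSupIndep_range_of_orthogonal {ι V : Type*} [AddCommGroup V] [Module ℂ V]
    {A : ι → Type*} [∀ i, AddCommGroup (A i)] [∀ i, Module ℂ (A i)]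
    (B : LinearMap.BilinForm ℂ V) (α : ∀ i, A i →ₗ[ℂ] V)
    (horth : ∀ i j, i ≠ j → ∀ x y, B (α i x) (α j y) = 0)
    (hnd : ∀ i x, (∀ y, B (α i x) (α i y) = 0) → x = 0) :
    iSupIndep fun i => LinearMap.range (α i) := by
  intro i
  rw [Submodule.disjoint_def]
  rintro _ ⟨x, rfl⟩ hx
  have h : ∀ y, ⨆ j, ⨆ (_ : j ≠ i), LinearMap.range (α j) ≤ LinearMap.ker (B.flip (α i y)) := by
    intro y
    refine iSup₂_le fun j hj => ?_
    rintro _ ⟨w, rfl⟩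
    exact horth j i hj w y
  rw [hnd i x fun y => h y hx, map_zero]

namespace Arrangement

open HolGerm

variable {n k : ℕ} {a : Fin n → ℂ} {b : Fin n → Fin k → ℂ} {z : Fin n → ℂ} {p q : Fin k → ℂ}

/-! ### The contravariant form on the images of the local algebras -/

theorem alpha_sym (hp : p ∈ complement b z) (g : LocalAlgebra a b z hp) (s : Fin k → Fin n) :
    alpha a b z hp g (sym b z s) =
      residue (gradGerm a b z hp) (g * Ideal.Quotient.mk _ (symGerm b z hp s)) := by
  have h : canonicalElement b z hp (sym b z s) = symGerm b z hp s :=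
    (Finsupp.linearCombination_single ℂ 1 s).trans (one_smul ℂ _)
  change residue (gradGerm a b z hp)
    (g * Ideal.Quotient.mk _ (canonicalElement b z hp (sym b z s))) = _
  rw [h]

/-- The combinations `∑_j a_j (H_j) · η` have coefficient functions in the Jacobian ideal. -/
theorem alpha_mem_singFlag (hp : p ∈ complement b z) (g : LocalAlgebra a b z hp) :
    alpha a b z hp g ∈ singFlag a b z k := by
  cases k with
  | zero => simp [singFlag, nuImage]
  | succ k =>
    rw [singFlag, Submodule.mem_dualAnnihilator]
    intro η hη
    refine Submodule.span_le (p := LinearMap.ker (alpha a b z hp g)).2 ?_ hη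
    rintro _ ⟨s, rfl⟩
    change alpha a b z hp g _ = 0
    rw [map_sum]
    simp only [map_smul, alpha_sym]
    -- The cofactors of the first row do not depend on `j`.
    let cof : Fin (k + 1) → ℂ := fun i =>
      (-1) ^ (i : ℕ) * (Matrix.of fun l m => b (s l) (i.succAbove m)).det
    have hdet : ∀ j, (Matrix.of fun l i => b ((Fin.cons j s : Fin (k + 1) → Fin n) l) i).det =
        ∑ i, b j i * cof i := by
      intro j
      rw [Matrix.det_succ_row_zero]
      refine Finset.sum_congr rfl fun i _ => ?_
      simp only [Matrix.of_apply, Fin.cons_zero, cof]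
      have : (Matrix.of fun l i => b ((Fin.cons j s : Fin (k + 1) → Fin n) l) i).submatrix
          Fin.succ i.succAbove = Matrix.of fun l m => b (s l) (i.succAbove m) := rfl
      rw [this]
      ring
    have hmem : ∑ j, algebraMap ℂ (HolGerm p) (a j) *
        symGerm b z hp (Fin.cons j s : Fin (k + 1) → Fin n) ∈
          Ideal.span (Set.range (gradGerm a b z hp)) := by
      have : ∑ j, algebraMap ℂ (HolGerm p) (a j) *
          symGerm b z hp (Fin.cons j s : Fin (k + 1) → Fin n) =
          ∑ i, (algebraMap ℂ _ (cof i) * ∏ l, invGerm b z hp (s l)) * gradGerm a b z hp i := by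
        simp only [symGerm_eq, hdet, Fin.prod_univ_succ, Fin.cons_zero, Fin.cons_succ, gradGerm_eq,
          map_sum, map_mul, Finset.mul_sum, Finset.sum_mul]
        rw [Finset.sum_comm]
        refine Finset.sum_congr rfl fun i _ => Finset.sum_congr rfl fun j _ => ?_
        ring
      rw [this]
      exact Ideal.sum_mem _ fun i _ => Ideal.mul_mem_left _ _ (Ideal.subset_span ⟨i, rfl⟩)
    have hz := Ideal.Quotient.eq_zero_iff_mem.2 hmem
    rw [map_sum] at hz
    have hsum : ∑ j, a j • (g * Ideal.Quotient.mk (Ideal.span (Set.range (gradGerm a b z hp)))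
        (symGerm b z hp (Fin.cons j s : Fin (k + 1) → Fin n))) = 0 := by
      rw [← mul_zero g, ← hz, Finset.mul_sum]
      refine Finset.sum_congr rfl fun j _ => ?_
      rw [← mul_smul_comm, Algebra.smul_def, map_mul]
      rfl
    rw [← map_zero (residue (gradGerm a b z hp)), ← hsum, map_sum]
    exact Finset.sum_congr rfl fun j _ => (map_smul _ _ _).symm

open Classical in
/-- Pairing the Bezoutian at `q` with `h` by the residue. -/
theorem sum_functional_smul (hp : p ∈ complement b z) (hq : q ∈ complement b z)
    (D : ResidueFrame (gradGerm a b z hq)) (h : HolGerm q) :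
    (∑ s : Fin k → Fin n with StrictMono s,
      ((∏ i, a (s i)) * D.functional (symGerm b z hq s * h)) •
        (Ideal.Quotient.mk _ (symGerm b z hp s) : LocalAlgebra a b z hp)) =
      (-1) ^ k * MvPowerSeries.coeff (MonomialPresentation.top k D.N)
        ((bezoutMatrix a b z hp hq).det *
          taylorOver (LocalAlgebra a b z hp) q (D.c.det * h)) := by
  have hsgn : ((-1 : MvPowerSeries (Fin k) (LocalAlgebra a b z hp)) ^ k) =
      MvPowerSeries.C ((-1) ^ k) := by simp
  rw [det_bezoutMatrix, hsgn, mul_assoc, MvPowerSeries.coeff_C_mul, ← mul_assoc, ← mul_pow,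
    neg_one_mul, neg_neg, one_pow, one_mul, Finset.sum_mul, map_sum]
  refine Finset.sum_congr rfl fun s _ => ?_
  rw [mul_assoc, MvPowerSeries.coeff_C_mul, ← map_mul (taylorOver _ q), coeff_taylorOver,
    Algebra.smul_def, map_mul (algebraMap ℂ _)]
  have : D.functional (symGerm b z hq s * h) =
      coeff q (MonomialPresentation.top k D.N) (symGerm b z hq s * (D.c.det * h)) := by
    change coeff q _ (D.c.det * (symGerm b z hq s * h)) = _
    rw [mul_left_comm]
    rfl
  rw [this]
  ring

/-- The contravariant form on `A_p × A_q` is the iterated residue of the Bezoutian. -/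
theorem contravariantForm_alpha (hp : p ∈ complement b z) (hq : q ∈ complement b z)
    (hD : Nonempty (ResidueFrame (gradGerm a b z hq))) (g : LocalAlgebra a b z hp)
    (h : HolGerm q) :
    contravariantForm a b z k (alpha a b z hp g) (alpha a b z hq (Ideal.Quotient.mk _ h)) =
      residue (gradGerm a b z hp) (g * ((-1) ^ k *
        MvPowerSeries.coeff (MonomialPresentation.top k hD.some.N)
        ((bezoutMatrix a b z hp hq).det *
          taylorOver (LocalAlgebra a b z hp) q (hD.some.c.det * h)))) := by
  classical
  rw [← sum_functional_smul, Finset.mul_sum, map_sum, contravariantForm,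
    LinearMap.BilinForm.sum_apply]
  refine Finset.sum_congr (by congr) fun s _ => ?_
  rw [mul_smul_comm, map_smul]
  change (∏ i, a (s i)) * (alpha a b z hp g (sym b z s) *
    alpha a b z hq (Ideal.Quotient.mk _ h) (sym b z s)) = _
  rw [alpha_sym, alpha_sym, ← map_mul, residue_mk hD, mul_comm h, smul_eq_mul]
  ring

/-- The images of the local algebras at different points are orthogonal. -/
theorem contravariantForm_alpha_of_ne (hp : p ∈ complement b z) (hq : q ∈ complement b z)
    (hDp : Nonempty (ResidueFrame (gradGerm a b z hp)))
    (hDq : Nonempty (ResidueFrame (gradGerm a b z hq))) (hpq : p ≠ q)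
    (g : LocalAlgebra a b z hp) (h : LocalAlgebra a b z hq) :
    contravariantForm a b z k (alpha a b z hp g) (alpha a b z hq h) = 0 := by
  obtain ⟨h, rfl⟩ := Ideal.Quotient.mk_surjective h
  obtain ⟨l, hl⟩ := Function.ne_iff.1 hpq
  have hu : IsUnit (shift a hp q l) := by
    have h1 : IsNilpotent (Ideal.Quotient.mk (Ideal.span (Set.range (gradGerm a b z hp)))
        (coord p l)) := ⟨hDp.some.N + 1, by
      rw [← map_pow]
      exact Ideal.Quotient.eq_zero_iff_mem.2 (hDp.some.coord_pow_mem l)⟩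
    have h2 : IsUnit (algebraMap ℂ (LocalAlgebra a b z hp) (p l - q l)) :=
      (isUnit_iff_ne_zero.2 (sub_ne_zero.2 hl)).map _
    exact h1.isUnit_add_right_of_commute h2 (Commute.all _ _)
  rw [contravariantForm_alpha hp hq hDq, hDq.some.coeff_det_mul_eq_zero _ _
    (bezoutMatrix_mulVec hp hq) l hu, mul_zero, mul_zero, map_zero]

theorem coeff_bezoutMatrix_self (hp : p ∈ complement b z)
    (D : ResidueFrame (gradGerm a b z hp)) (h : HolGerm p) :
    MvPowerSeries.coeff (MonomialPresentation.top k D.N) ((bezoutMatrix a b z hp hp).det *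
      taylorOver (LocalAlgebra a b z hp) p (D.c.det * h)) = Ideal.Quotient.mk _ h := by
  refine D.coeff_det_mul_eq _ (fun i => ?_) h
  have h1 := bezoutMatrix_mulVec (a := a) hp hp i
  simpa only [shift, sub_self, map_zero, add_zero] using h1

/-- Up to a sign, `α_p` takes the residue form to the contravariant form. -/
theorem contravariantForm_alpha_self (hp : p ∈ complement b z)
    (hD : Nonempty (ResidueFrame (gradGerm a b z hp))) (g h : LocalAlgebra a b z hp) :
    contravariantForm a b z k (alpha a b z hp g) (alpha a b z hp h) =
      (-1) ^ k * residueForm a b z hp g h := by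
  obtain ⟨h, rfl⟩ := Ideal.Quotient.mk_surjective h
  rw [contravariantForm_alpha hp hp hD, coeff_bezoutMatrix_self]
  have : g * ((-1) ^ k * Ideal.Quotient.mk (Ideal.span (Set.range (gradGerm a b z hp))) h) =
      ((-1 : ℂ) ^ k) • (g * Ideal.Quotient.mk _ h) := by
    rw [Algebra.smul_def, map_pow, map_neg, map_one]
    ring
  rw [this, map_smul]
  rfl

/-- The residue form is nondegenerate: the Bezoutian recovers `h` from its residue pairings. -/
theorem eq_zero_of_residueForm_eq_zero (hp : p ∈ complement b z)
    (hD : Nonempty (ResidueFrame (gradGerm a b z hp))) (h : LocalAlgebra a b z hp)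
    (h0 : ∀ g, residueForm a b z hp h g = 0) : h = 0 := by
  classical
  obtain ⟨h, rfl⟩ := Ideal.Quotient.mk_surjective h
  have h1 := sum_functional_smul hp hp hD.some h
  rw [coeff_bezoutMatrix_self, Finset.sum_eq_zero] at h1
  · have hu : IsUnit ((-1 : LocalAlgebra a b z hp) ^ k) := (isUnit_one.neg).pow k
    exact (hu.mul_right_eq_zero).1 h1.symm
  · intro s _
    have h2 : hD.some.functional (symGerm b z hp s * h) = 0 := by
      rw [mul_comm, ← residue_mk hD, map_mul]
      exact h0 _
    rw [h2, mul_zero, zero_smul]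

theorem eq_zero_of_contravariantForm_alpha_eq_zero (hp : p ∈ complement b z)
    (hD : Nonempty (ResidueFrame (gradGerm a b z hp))) (h : LocalAlgebra a b z hp)
    (h0 : ∀ g, contravariantForm a b z k (alpha a b z hp h) (alpha a b z hp g) = 0) : h = 0 := by
  refine eq_zero_of_residueForm_eq_zero hp hD h fun g => ?_
  have h1 := h0 g
  rw [contravariantForm_alpha_self hp hD] at h1
  exact (mul_eq_zero.1 h1).resolve_left (pow_ne_zero _ (neg_ne_zero.2 one_ne_zero))

end Arrangement

end

theorem mainTheorem4 {n k : ℕ} (hk : 0 < k) (hkn : k < n)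
    (b : Fin n → Fin k → ℂ) (hb : ∀ j, b j ≠ 0) (hspan : Submodule.span ℂ (Set.range b) = ⊤)
    (a : Fin n → ℂ) (ha : ∀ j, a j ≠ 0) (z : Fin n → ℂ) :
    (∀ p : Arrangement.isolatedCriticalSet a b z,
      Module.Finite ℂ (Arrangement.LocalAlgebra a b z p.2.1.1) ∧
      Arrangement.Y a b z p.2.1.1 ≤ Arrangement.singW a b z) ∧
    iSupIndep (fun p : Arrangement.isolatedCriticalSet a b z => Arrangement.Y a b z p.2.1.1) ∧
    (∀ p q : Arrangement.isolatedCriticalSet a b z, p ≠ q →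
      ∀ x ∈ Arrangement.Y a b z p.2.1.1, ∀ y ∈ Arrangement.Y a b z q.2.1.1,
        Arrangement.formW a b z x y = 0) ∧
    (Arrangement.isolatedCriticalSet a b z).Finite ∧
    ∑ᶠ p : Arrangement.isolatedCriticalSet a b z, Arrangement.milnorNumber a b z p.2.1.1 ≤
      bilinRank ((Arrangement.formW a b z).restrict (Arrangement.singW a b z)) ∧
    ∑ᶠ p : Arrangement.isolatedCriticalSet a b z, Arrangement.milnorNumber a b z p.2.1.1 ≤
      bilinRank ((Arrangement.contravariantForm a b z k).restrict
        (Arrangement.singFlag a b z k)) := by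

  classical
  have hD := fun p : Arrangement.isolatedCriticalSet a b z =>
    Arrangement.nonempty_residueFrame_gradGerm p.2
  have hfin : ∀ p : Arrangement.isolatedCriticalSet a b z,
      Module.Finite ℂ (Arrangement.LocalAlgebra a b z p.2.1.1) := fun p => (hD p).some.finite
  have horth : ∀ p q : Arrangement.isolatedCriticalSet a b z, p ≠ q → ∀ g h,
      Arrangement.contravariantForm a b z k (Arrangement.alpha a b z p.2.1.1 g)
        (Arrangement.alpha a b z q.2.1.1 h) = 0 := fun p q hpq g h =>
    Arrangement.contravariantForm_alpha_of_ne p.2.1.1 q.2.1.1 (hD p) (hD q)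
      (fun h => hpq (Subtype.ext h)) g h
  have hnd : ∀ (p : Arrangement.isolatedCriticalSet a b z) h, (∀ g,
      Arrangement.contravariantForm a b z k (Arrangement.alpha a b z p.2.1.1 h)
        (Arrangement.alpha a b z p.2.1.1 g) = 0) → h = 0 := fun p h h0 =>
    Arrangement.eq_zero_of_contravariantForm_alpha_eq_zero p.2.1.1 (hD p) h h0
  have hform : ∀ v w, Arrangement.formW a b z (Arrangement.toW a b z v)
      (Arrangement.toW a b z w) = Arrangement.contravariantForm a b z k v w :=
    imageForm_apply _ _
  have hV := sum_finrank_le_bilinRank (Arrangement.contravariantForm a b z k)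
    (Arrangement.singFlag a b z k)
    (fun p : Arrangement.isolatedCriticalSet a b z => Arrangement.alpha a b z p.2.1.1)
    (fun p g => Arrangement.alpha_mem_singFlag p.2.1.1 g) horth hnd
  have hsing : ∀ (p : Arrangement.isolatedCriticalSet a b z) g,
      (Arrangement.toW a b z ∘ₗ Arrangement.alpha a b z p.2.1.1) g ∈
        Arrangement.singW a b z := fun p g =>
    Submodule.mem_map_of_mem (Arrangement.alpha_mem_singFlag p.2.1.1 g)
  have horthW : ∀ p q : Arrangement.isolatedCriticalSet a b z, p ≠ q → ∀ g h,
      Arrangement.formW a b z ((Arrangement.toW a b z ∘ₗ Arrangement.alpha a b z p.2.1.1) g)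
        ((Arrangement.toW a b z ∘ₗ Arrangement.alpha a b z q.2.1.1) h) = 0 := fun p q hpq g h =>
    (hform _ _).trans (horth p q hpq g h)
  have hndW : ∀ (p : Arrangement.isolatedCriticalSet a b z) h, (∀ g,
      Arrangement.formW a b z ((Arrangement.toW a b z ∘ₗ Arrangement.alpha a b z p.2.1.1) h)
        ((Arrangement.toW a b z ∘ₗ Arrangement.alpha a b z p.2.1.1) g) = 0) → h = 0 :=
    fun p h h0 => hnd p h fun g => (hform _ _).symm.trans (h0 g)
  have hW := sum_finrank_le_bilinRank (Arrangement.formW a b z) (Arrangement.singW a b z)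
    (fun p : Arrangement.isolatedCriticalSet a b z =>
      Arrangement.toW a b z ∘ₗ Arrangement.alpha a b z p.2.1.1) hsing horthW hndW
  -- Every Milnor number is positive, so the rank bounds the number of points.
  have hfinite : (Arrangement.isolatedCriticalSet a b z).Finite := by
    by_contra hinf
    have : Infinite (Arrangement.isolatedCriticalSet a b z) := Set.infinite_coe_iff.2 hinf
    obtain ⟨t, -, ht⟩ := (Set.infinite_univ (α := Arrangement.isolatedCriticalSet a b z)
      ).exists_subset_card_eq (bilinRank ((Arrangement.contravariantForm a b z k).restrict
        (Arrangement.singFlag a b z k)) + 1)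
    have h1 : t.card ≤ ∑ p ∈ t, Module.finrank ℂ (Arrangement.LocalAlgebra a b z p.2.1.1) := by
      rw [Finset.card_eq_sum_ones]
      refine Finset.sum_le_sum fun p _ => ?_
      have := Arrangement.nontrivial_localAlgebra p.2.1
      exact Module.finrank_pos
    have h2 := hV t
    omega
  have := hfinite.fintype
  refine ⟨fun p => ⟨hfin p, ?_⟩, iSupIndep_range_of_orthogonal _ _ horthW hndW, ?_, hfinite, ?_, ?_⟩
  · rintro _ ⟨g, rfl⟩
    exact hsing p g
  · rintro p q hpq _ ⟨g, rfl⟩ _ ⟨h, rfl⟩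
    exact horthW p q hpq g h
  · rw [finsum_eq_sum_of_fintype]
    exact hW Finset.univ
  · rw [finsum_eq_sum_of_fintype]
    exact hV Finset.univ
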